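/- Let $k$ be a field, let $n\ge 2$ be an integer, and put $V=H^0(\mathbb P^1,\mathcal O(n-2))$, the space of binary forms of degree $n-2$ in $x_0,x_1$ over $k$. Let $C_r\subset\mathbb P^n$ be the rational normal curve, the image of the Veronese embedding $\mathbb P^1\to\mathbb P^n$ under which the homogeneous coordinate $u_i$ pulls back to $x_0^ix_1^{n-i}$ $(0\le i\le n)$, with ideal sheaf $\mathcal I_{C_r}$. A \emph{canonical ribbon} thickening $C_r$ is a closed subscheme $\mathcal R\subset\mathbb P^n$ whose ideal sheaf is the kernel of a surjective morphism of sheaves of modules $\mathcal I_{C_r}\to\mathcal I_{C_r}/\mathcal I_{C_r}^2\to\omega_{C_r}(-1)\simeq\mathcal O_{\mathbb P^1}(-n-2)$. The conormal sheaf $\mathcal I_{C_r}/\mathcal I_{C_r}^2$ is identified with $V\otimes\mathcal O_{\mathbb P^1}(-n-2)$ by letting the basis element $x_0^ix_1^{n-2-i}$ of $V$ correspond to $\beta_i=x_0^2\,du_i-2x_0x_1\,du_{i+1}+x_1^2\,du_{i+2}$ $(0\le i\le n-2)$, where the class of a local section $f$ of $\mathcal I_{C_r}$ is $df$ restricted to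 $C_r$. For $0\ne\lambda\in V^*$, let $\mathcal R_\lambda$ be the canonical ribbon defined by the surjection $\lambda\otimes\mathrm{id}:V\otimes\mathcal O_{\mathbb P^1}(-n-2)\to\mathcal O_{\mathbb P^1}(-n-2)$. Let $S_2V\subset V\otimes V$ be the subspace of symmetric tensors. Identifying $H^0(\mathbb P^n,\mathcal O(1))$ with $H^0(\mathbb P^1,\mathcal O(n))$ via $u_i\leftrightarrow x_0^ix_1^{n-i}$, the linear map $S_2V\to H^0(\mathbb P^n,\mathcal O(2))$ with $f\otimes f\mapsto (x_0^2f)(x_1^2f)-(x_0x_1f)^2$ is an isomorphism of $S_2V$ onto $H^0(\mathbb P^n,\mathcal I_{C_r}(2))$, so that $q\in S_2V$ is regarded as a quadric containing $C_r$. Then: (i) For every nonzero $\lambda\in V^*$ and every $q\in S_2V$, the quadric $q$ vanishes on the canonical ribbon $\mathcal R_\lambda$ if and only if $(\lambda\otimes\mathrm{id})(q)=0$ in $V$. (ii) A quadric $q\in S_2V$ vanishes on some canonical ribbon thickening $C_r$ if and only if $\det(q)=0$, where $\det(q)$ is the determinant of the symmetric matrix of $q$ in a basis of $V$ (its vanishing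 does not depend on the basis). -/

import Mathlib

open AlgebraicGeometry CategoryTheory MvPolynomial TensorProduct

universe u

namespace CanonicalRibbon

noncomputable section

variable (k : Type u) [Field k]

/-- `H⁰(ℙ¹, 𝒪(m))`: binary forms of degree `m` in the coordinates `x₀ = X 0`, `x₁ = X 1`. -/
abbrev Forms (m : ℕ) : Type u := homogeneousSubmodule (Fin 2) k m

/-- The standard grading on the coordinate ring `k[u₀, …, uₙ]` of `ℙⁿ`. -/
abbrev grading (n : ℕ) : ℕ → Submodule k (MvPolynomial (Fin (n + 1)) k) :=
  homogeneousSubmodule (Fin (n + 1)) k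

instance gradingGradedAlgebra (n : ℕ) : GradedAlgebra (grading k n) :=
  MvPolynomial.gradedAlgebra

/-- Projective space `ℙⁿ` over `k`, as a scheme. -/
abbrev projSpace (n : ℕ) : Scheme.{u} := Proj (grading k n)

/-- The coordinate ring `k[u₀, …, uₙ]_(u_a)` of the standard affine chart `D₊(u_a)` of `ℙⁿ`. -/
abbrev Chart (n : ℕ) (a : Fin (n + 1)) : Type u :=
  HomogeneousLocalization.Away (grading k n) (X a)

lemma X_mem_grading (n : ℕ) (a : Fin (n + 1)) :
    (X a : MvPolynomial (Fin (n + 1)) k) ∈ grading k n 1 :=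
  (mem_homogeneousSubmodule 1 _).2 (isHomogeneous_X k a)

variable {k}

/-- The regular function `F / u_a ^ d` on the chart `D₊(u_a)`, for a form `F` of degree `d`. -/
def dehomogenize {n d : ℕ} (F : grading k n d) (a : Fin (n + 1)) : Chart k n a :=
  HomogeneousLocalization.Away.mk (grading k n) (X_mem_grading k n a) d F.1
    (by simp)

/-- The ideal of the coordinate ring of `D₊(u_a)` that cuts out there the closed subscheme of `ℙⁿ`
with ideal sheaf `J`. -/
def chartIdeal {n : ℕ} (J : (projSpace k n).IdealSheafData) (a : Fin (n + 1)) :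
    Ideal (Chart k n a) :=
  (J.ideal ⟨Proj.basicOpen (grading k n) (X a),
    Proj.isAffineOpen_basicOpen (grading k n) (X a) (X_mem_grading k n a) Nat.one_pos⟩).comap
    (Proj.awayToSection (grading k n) (X a)).hom

/-- A form `F` of degree `d`, as a section of `𝒪(d)`, vanishes on the closed subscheme with ideal
sheaf `J`. -/
def VanishesOn {n d : ℕ} (F : grading k n d) (J : (projSpace k n).IdealSheafData) : Prop :=
  ∀ a, dehomogenize F a ∈ chartIdeal J a

/-- The ideal sheaf of the closed subscheme of `ℙⁿ` defined by a homogeneous ideal `I`. On `D₊(u_a)`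
this subscheme is cut out by the degree-zero part of the localization of `I`; the pieces are glued
as a scheme-theoretic union of scheme-theoretic images (an infimum of ideal sheaves). -/
def idealSheaf {n : ℕ} (I : Ideal (MvPolynomial (Fin (n + 1)) k)) :
    (projSpace k n).IdealSheafData :=
  ⨅ a : Fin (n + 1),
    (Spec.map (CommRingCat.ofHom (Ideal.Quotient.mk
        ((I.map (algebraMap _ (Localization.Away (X a : MvPolynomial (Fin (n + 1)) k)))).comap
          (algebraMap (Chart k n a) (Localization.Away (X a : MvPolynomial (Fin (n + 1)) k)))))) ≫
      Proj.awayι (grading k n) (X a) (X_mem_grading k n a) Nat.one_pos).ker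

variable (k)

/-- The form `x₀ ^ i * x₁ ^ (n - i)`, the pullback of `u_i` under the Veronese embedding. -/
def veroneseMonomial (n : ℕ) (i : Fin (n + 1)) : MvPolynomial (Fin 2) k :=
  X 0 ^ (i : ℕ) * X 1 ^ (n - (i : ℕ))

/-- The homomorphism `k[u₀, …, uₙ] → k[x₀, x₁]`, `u_i ↦ x₀ ^ i * x₁ ^ (n - i)`, which restricts
forms to the image of the Veronese embedding `ℙ¹ → ℙⁿ`. -/
def veronese (n : ℕ) : MvPolynomial (Fin (n + 1)) k →ₐ[k] MvPolynomial (Fin 2) k :=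
  aeval (veroneseMonomial k n)

/-- The ideal sheaf of the rational normal curve, the image of the Veronese embedding. -/
def rationalNormalCurve (n : ℕ) : (projSpace k n).IdealSheafData :=
  idealSheaf (RingHom.ker (veronese k n))

/-- Rational functions in `x₀, x₁`; all twisting sheaves of `ℙ¹` have their sections here. -/
abbrev Rat₂ : Type u := FractionRing (MvPolynomial (Fin 2) k)

lemma veroneseMonomial_ne_zero (n : ℕ) (a : Fin (n + 1)) : veroneseMonomial k n a ≠ 0 :=
  mul_ne_zero (pow_ne_zero _ (X_ne_zero _)) (pow_ne_zero _ (X_ne_zero _))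

/-- Restriction of a regular function on `D₊(u_a) ⊆ ℙⁿ` to the rational normal curve. -/
def restrict (n : ℕ) (a : Fin (n + 1)) : Chart k n a →+* Rat₂ k :=
  (IsLocalization.Away.lift (S := Localization.Away (X a : MvPolynomial (Fin (n + 1)) k))
    (X a : MvPolynomial (Fin (n + 1)) k)
    (g := (algebraMap (MvPolynomial (Fin 2) k) (Rat₂ k)).comp (veronese k n).toRingHom)
    (by
      have h : algebraMap (MvPolynomial (Fin 2) k) (Rat₂ k) (veroneseMonomial k n a) ≠ 0 :=
        (map_ne_zero_iff _ (IsFractionRing.injective _ _)).2 (veroneseMonomial_ne_zero k n a)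
      simpa [veronese] using h)).comp
  (algebraMap (Chart k n a) (Localization.Away (X a : MvPolynomial (Fin (n + 1)) k)))

/-- Sections of `𝒪_{ℙ¹}(m)` over the preimage `D₊(x₀ ^ a * x₁ ^ (n - a))` of the chart `D₊(u_a)`
under the Veronese embedding: fractions `s / (x₀ ^ a * x₁ ^ (n - a)) ^ N` of degree `m`. -/
def twistSections (n : ℕ) (a : Fin (n + 1)) (m : ℤ) : Set (Rat₂ k) :=
  {z | ∃ (N e : ℕ) (s : Forms k e), (e : ℤ) = N * n + m ∧
    z * algebraMap _ (Rat₂ k) (veroneseMonomial k n a ^ N) = algebraMap _ (Rat₂ k) s.1}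

variable {k}

/-- `J` is the ideal sheaf of a canonical ribbon in `ℙⁿ` thickening the rational normal curve `C`:
it is the kernel of a surjective morphism of sheaves of modules `I_C → ω_C(-1)`, where
`ω_C(-1)` is the line bundle `𝒪(-2) ⊗ 𝒪(-n) = 𝒪(-n-2)` on `C ≅ ℙ¹`. (Any such morphism kills
`I_C ^ 2`, so it is the same as a surjection from the conormal sheaf.) The morphism is given by
additive maps `ψ a` on the standard charts that are linear over the regular functions and agree on
overlaps. -/
def IsCanonicalRibbon {n : ℕ} (J : (projSpace k n).IdealSheafData) : Prop :=
  J ≤ rationalNormalCurve k n ∧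
  ∃ ψ : ∀ a : Fin (n + 1), chartIdeal (rationalNormalCurve k n) a →+ Rat₂ k,
    (∀ a (f : Chart k n a) (g : chartIdeal (rationalNormalCurve k n) a),
      ψ a (f • g) = restrict k n a f * ψ a g) ∧
    (∀ (a b : Fin (n + 1)) (d : ℕ) (F : grading k n d)
      (ha : dehomogenize F a ∈ chartIdeal (rationalNormalCurve k n) a)
      (hb : dehomogenize F b ∈ chartIdeal (rationalNormalCurve k n) b),
      algebraMap _ (Rat₂ k) (veroneseMonomial k n a ^ d) * ψ a ⟨dehomogenize F a, ha⟩ =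
        algebraMap _ (Rat₂ k) (veroneseMonomial k n b ^ d) * ψ b ⟨dehomogenize F b, hb⟩) ∧
    (∀ a, Set.range (ψ a) = twistSections k n a (-(n + 2 : ℤ))) ∧
    (∀ a (g : chartIdeal (rationalNormalCurve k n) a),
      ψ a g = 0 ↔ (g : Chart k n a) ∈ chartIdeal J a)

variable (k)

/-- The basis form `x₀ ^ i * x₁ ^ (n - 2 - i)` of `H⁰(ℙ¹, 𝒪(n - 2))`, for `0 ≤ i ≤ n - 2`. -/
def monomialForm (n : ℕ) (i : Fin (n - 1)) : Forms k (n - 2) :=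
  ⟨X 0 ^ (i : ℕ) * X 1 ^ (n - 2 - (i : ℕ)), by
    rw [mem_homogeneousSubmodule]
    have h := (isHomogeneous_X_pow (R := k) (0 : Fin 2) (i : ℕ)).mul
      (isHomogeneous_X_pow (R := k) (1 : Fin 2) (n - 2 - (i : ℕ)))
    rwa [show (i : ℕ) + (n - 2 - (i : ℕ)) = n - 2 by have := i.2; omega] at h⟩

/-- The coefficient of `du_j` in the generator
`β_i = x₀² du_i - 2 x₀ x₁ du_{i+1} + x₁² du_{i+2}` of the conormal bundle. -/
def beta (n : ℕ) (i : Fin (n - 1)) (j : Fin (n + 1)) : MvPolynomial (Fin 2) k :=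
  if (j : ℕ) = i then X 0 ^ 2
  else if (j : ℕ) = i + 1 then -2 * X 0 * X 1
  else if (j : ℕ) = i + 2 then X 1 ^ 2
  else 0

variable {k}

/-- `g` is the vector of coordinates of the conormal class of `F` in the basis `β_i`, that is
`dF = ∑ i, g i • β_i` along the rational normal curve. This basis is the isomorphism of the conormal
bundle with `H⁰(ℙ¹, 𝒪(n - 2)) ⊗ 𝒪(-n-2)`, where `β_i` corresponds to `x₀ ^ i * x₁ ^ (n-2-i)`. -/
def IsConormalClass {n : ℕ} (F : MvPolynomial (Fin (n + 1)) k)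
    (g : Fin (n - 1) → MvPolynomial (Fin 2) k) : Prop :=
  ∀ j, veronese k n (pderiv j F) = ∑ i, g i * beta k n i j

/-- The homogeneous ideal of the ribbon attached to `lam`: the elements of the ideal of the
rational normal curve whose conormal class is killed by
`lam ⊗ id : H⁰(ℙ¹, 𝒪(n - 2)) ⊗ 𝒪(-n-2) → 𝒪(-n-2)`. -/
def ribbonIdeal {n : ℕ} (lam : Module.Dual k (Forms k (n - 2))) :
    Ideal (MvPolynomial (Fin (n + 1)) k) where
  carrier := {F | veronese k n F = 0 ∧
    ∃ g, IsConormalClass F g ∧ ∑ i, lam (monomialForm k n i) • g i = 0}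
  zero_mem' := ⟨map_zero _, 0, fun j => by simp, by simp⟩
  add_mem' := by
    rintro F G ⟨hF, f, hf, hf'⟩ ⟨hG, g, hg, hg'⟩
    refine ⟨by simp [hF, hG], f + g, fun j => ?_, ?_⟩
    · simp [hf j, hg j, add_mul, Finset.sum_add_distrib]
    · simp [smul_add, Finset.sum_add_distrib, hf', hg']
  smul_mem' := by
    rintro H F ⟨hF, f, hf, hf'⟩
    refine ⟨by simp [hF], fun i => veronese k n H * f i, fun j => ?_, ?_⟩
    · simp [hf j, hF, Finset.mul_sum, mul_assoc]
    · rw [← mul_zero (veronese k n H), ← hf', Finset.mul_sum]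
      exact Finset.sum_congr rfl fun i _ => (mul_smul_comm _ _ _).symm

/-- The ideal sheaf of the ribbon `R_lam`. -/
def ribbon {n : ℕ} (lam : Module.Dual k (Forms k (n - 2))) : (projSpace k n).IdealSheafData :=
  idealSheaf (ribbonIdeal lam)

/-- The linear form on `ℙⁿ` that corresponds to a binary form of degree `n` under
`H⁰(ℙ¹, 𝒪(n)) = H⁰(ℙⁿ, 𝒪(1))`, `x₀ ^ i * x₁ ^ (n - i) ↔ u_i`. -/
def toLinearForm (n : ℕ) : MvPolynomial (Fin 2) k →ₗ[k] MvPolynomial (Fin (n + 1)) k :=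
  ∑ i : Fin (n + 1),
    (lcoeff k (Finsupp.single 0 (i : ℕ) + Finsupp.single 1 (n - (i : ℕ)))).smulRight (X i)

lemma toLinearForm_isHomogeneous (n : ℕ) (f : MvPolynomial (Fin 2) k) :
    (toLinearForm n f).IsHomogeneous 1 := by
  rw [← mem_homogeneousSubmodule]
  simp only [toLinearForm, LinearMap.sum_apply, LinearMap.smulRight_apply]
  exact Submodule.sum_mem _ fun i _ => Submodule.smul_mem _ _ (X_mem_grading k n i)

/-- The linear map on `H⁰(ℙ¹, 𝒪(n - 2)) ⊗ H⁰(ℙ¹, 𝒪(n - 2))` given by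
`f ⊗ g ↦ (x₀² f)(x₁² g) - (x₀ x₁ f)(x₀ x₁ g)`. On symmetric tensors it is the linear map attached to
the quadratic map `f ↦ (x₀² f)(x₁² f) - (x₀ x₁ f)²`. -/
def quadric (n : ℕ) : Forms k (n - 2) ⊗[k] Forms k (n - 2) →ₗ[k] grading k n 2 :=
  TensorProduct.lift (LinearMap.mk₂ k
    (fun f g => ⟨toLinearForm n (X 0 ^ 2 * f.1) * toLinearForm n (X 1 ^ 2 * g.1) -
        toLinearForm n (X 0 * X 1 * f.1) * toLinearForm n (X 0 * X 1 * g.1),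
      (mem_homogeneousSubmodule 2 _).2
        (((toLinearForm_isHomogeneous n _).mul (toLinearForm_isHomogeneous n _)).sub
          ((toLinearForm_isHomogeneous n _).mul (toLinearForm_isHomogeneous n _)))⟩)
    (fun f₁ f₂ g => Subtype.ext (by simp [mul_add]; ring))
    (fun c f g => Subtype.ext (by simp [smul_sub]))
    (fun f g₁ g₂ => Subtype.ext (by simp [mul_add]; ring))
    (fun c f g => Subtype.ext (by simp [smul_sub])))

/-- The subspace `S₂V ⊆ V ⊗ V` of symmetric tensors. -/
def symmTensors (V : Type u) [AddCommGroup V] [Module k V] : Submodule k (V ⊗[k] V) :=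
  LinearMap.eqLocus (TensorProduct.comm k V V).toLinearMap LinearMap.id

/-- The contraction `lam ⊗ id : V ⊗ V → V`. -/
def contract {V : Type u} [AddCommGroup V] [Module k V] (lam : Module.Dual k V) :
    V ⊗[k] V →ₗ[k] V :=
  (TensorProduct.lid k V).toLinearMap ∘ₗ lam.rTensor V

/-- The matrix of a tensor `∑ i j, M i j • (b i ⊗ b j)` in the basis `b`. -/
def tensorMatrix {V ι : Type*} [AddCommGroup V] [Module k V] (b : Module.Basis ι k V)
    (q : V ⊗[k] V) : Matrix ι ι k :=
  Matrix.of fun i j => (b.tensorProduct b).repr q (i, j)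

end

end CanonicalRibbon

/-! The proof reduces vanishing on a ribbon to a first-order computation along the curve. A
polynomial is evaluated at `v + εℓ`, where `v` is the Veronese point and `ℓ` is a vector of rational
functions on the line (`deform`). If `F` vanishes on the curve, the ε-part is `dF(ℓ)`, so it depends
only on the conormal class of `F` and on the values `β_i(ℓ)` (`snd_deform_of_isConormalClass`). When
these values are the constants `λ(x₀^i x₁^(n-2-i))`, a form lies in the ideal of `R_λ` exactly when
`deform` kills it (`Represents.mem_ribbonIdeal_iff`). Such an `ℓ` exists over the function field by
solving a recursion.

For a symmetric tensor `q`, the β-coordinates of its quadric are the contractions of `q` with the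
dual monomial basis (`isConormalClass_quadric`). The ε-part is therefore `(λ ⊗ id)(q)`, which gives
(i). Contractions with all coordinate functionals recover `q`, so `quadric` is injective on
symmetric tensors. It is onto because the ideal of the curve is generated by 2×2 minors, each of
which comes from a symmetric tensor.

For (ii), a symmetric matrix is singular exactly when some nonzero `λ` contracts `q` to zero. If it
is singular, `R_λ` is the required ribbon. Conversely, any morphism defining a ribbon is linear on
forms vanishing on the curve, and a syzygy of the minors shows that it is `F ↦ dF(ℓ)` for some `ℓ`
(`IsModuleMap.exists_eq_deformMap`). Regularity on the first and last charts makes each `β_i(ℓ)` a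
constant, and these constants define `λ`. Surjectivity makes `λ` nonzero
(`IsCanonicalRibbon.exists_dual`). -/

namespace CanonicalRibbon

noncomputable section

/-! ### Sections of Proj on a standard chart. -/

section Away

variable {σ : Type*} {A : Type u} [CommRing A] [SetLike σ A] [AddSubgroupClass σ A]
  (𝒜 : ℕ → σ) [GradedRing 𝒜]

/-- The restriction of sections along the inclusion of a standard chart into `Proj`. -/
lemma awayToSection_appLE_awayι (f : A) {m : ℕ} (hf : f ∈ 𝒜 m) (hm : 0 < m)
    (h : ⊤ ≤ Proj.awayι 𝒜 f hf hm ⁻¹ᵁ Proj.basicOpen 𝒜 f) :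
    Proj.awayToSection 𝒜 f ≫ (Proj.awayι 𝒜 f hf hm).appLE (Proj.basicOpen 𝒜 f) ⊤ h =
      (Scheme.ΓSpecIso _).inv := by
  have h1 : (Proj.awayι 𝒜 f hf hm).appLE (Proj.basicOpen 𝒜 f) ⊤ h =
      (Proj.basicOpen 𝒜 f).topIso.inv ≫ (Proj.basicOpenIsoSpec 𝒜 f hf hm).inv.appTop := by
    have h2 : (Proj.basicOpen 𝒜 f).topIso.inv =
        (Proj.basicOpen 𝒜 f).ι.appLE (Proj.basicOpen 𝒜 f) ⊤ (by simp) := by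
      simp only [Scheme.Hom.appLE, Scheme.Opens.topIso_inv, Scheme.Opens.ι_app]
      exact ((Proj 𝒜).presheaf.map_comp _ _)
    have h4 : (Proj.basicOpenIsoSpec 𝒜 f hf hm).inv.appTop =
        (Proj.basicOpenIsoSpec 𝒜 f hf hm).inv.appLE ⊤ ⊤ le_rfl :=
      Scheme.Hom.app_eq_appLE _
    rw [h2, h4]
    exact (Scheme.Hom.appLE_comp_appLE _ _ _ _ _ _ _).symm
  have h3 : (Proj.basicOpenIsoSpec 𝒜 f hf hm).hom.appTop = (Scheme.ΓSpecIso _).hom ≫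
      Proj.awayToSection 𝒜 f ≫ (Proj.basicOpen 𝒜 f).topIso.inv :=
    Proj.basicOpenToSpec_app_top 𝒜 f
  rw [← Iso.inv_comp_eq] at h3
  rw [h1, ← Category.assoc, ← h3, Category.assoc, ← Scheme.Hom.comp_appTop, Iso.inv_hom_id,
    Scheme.Hom.id_appTop, Category.comp_id]

end Away

/-! ### The ideal sheaf of a homogeneous ideal, chart by chart. -/

variable {k : Type u} [Field k] {n : ℕ}

lemma dehomogenize_surjective (a : Fin (n + 1)) (z : Chart k n a) :
    ∃ (d : ℕ) (F : grading k n d), dehomogenize F a = z := by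
  obtain ⟨d, F, hF, rfl⟩ := HomogeneousLocalization.Away.mk_surjective (grading k n)
    (X_mem_grading k n a) z
  exact ⟨d, ⟨F, by simpa using hF⟩, rfl⟩

lemma algebraMap_dehomogenize {d : ℕ} (F : grading k n d) (a : Fin (n + 1)) :
    algebraMap (Chart k n a) (Localization.Away (X a : MvPolynomial (Fin (n + 1)) k))
      (dehomogenize F a) = IsLocalization.mk' _ F.1
        (⟨X a ^ d, d, rfl⟩ : Submonoid.powers (X a : MvPolynomial (Fin (n + 1)) k)) := by
  rw [← Localization.mk_eq_mk']
  rfl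

/-- The ideal of the chart `D₊(u_a)` cut out by a homogeneous ideal `I`. -/
abbrev localIdeal (I : Ideal (MvPolynomial (Fin (n + 1)) k)) (a : Fin (n + 1)) :
    Ideal (Chart k n a) :=
  (I.map (algebraMap _ (Localization.Away (X a : MvPolynomial (Fin (n + 1)) k)))).comap
    (algebraMap (Chart k n a) (Localization.Away (X a : MvPolynomial (Fin (n + 1)) k)))

lemma dehomogenize_mem_localIdeal_iff (I : Ideal (MvPolynomial (Fin (n + 1)) k))
    {d : ℕ} (F : grading k n d) (a : Fin (n + 1)) :
    dehomogenize F a ∈ localIdeal I a ↔ ∃ m, X a ^ m * F.1 ∈ I := by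
  rw [localIdeal, Ideal.mem_comap, algebraMap_dehomogenize,
    IsLocalization.mk'_mem_map_algebraMap_iff (Submonoid.powers _)]
  constructor
  · rintro ⟨_, ⟨m, rfl⟩, h⟩
    exact ⟨m, h⟩
  · rintro ⟨m, h⟩
    exact ⟨_, ⟨m, rfl⟩, h⟩

/-- The inverse of `u_a / u_b` on the overlap is `u_b² / (u_a u_b)`. -/
lemma isUnit_awayMap_ratio (a b : Fin (n + 1)) :
    IsUnit (HomogeneousLocalization.awayMap (grading k n) (X_mem_grading k n a)
      (mul_comm (X a) (X b)) (dehomogenize (⟨X a, X_mem_grading k n a⟩ : grading k n 1) b)) := by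
  have hab : (X a * X b : MvPolynomial (Fin (n + 1)) k) ∈ grading k n (1 + 1) :=
    SetLike.mul_mem_graded (X_mem_grading k n a) (X_mem_grading k n b)
  have hbb : (X b * X b : MvPolynomial (Fin (n + 1)) k) ∈ grading k n (1 • (1 + 1)) :=
    SetLike.mul_mem_graded (X_mem_grading k n b) (X_mem_grading k n b)
  refine IsUnit.of_mul_eq_one (HomogeneousLocalization.Away.mk (grading k n) hab 1 _ hbb) ?_
  rw [dehomogenize, HomogeneousLocalization.awayMap_mk]
  ext
  rw [HomogeneousLocalization.val_mul, HomogeneousLocalization.Away.val_mk,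
    HomogeneousLocalization.Away.val_mk, Localization.mk_mul, HomogeneousLocalization.val_one,
    ← Localization.mk_one, Localization.mk_eq_mk_iff, Localization.r_iff_exists]
  exact ⟨1, by simp; ring⟩

lemma awayMap_dehomogenize_mul {d : ℕ} (F : grading k n d) (a b : Fin (n + 1)) :
    HomogeneousLocalization.awayMap (grading k n) (X_mem_grading k n b)
        (rfl : (X a * X b : MvPolynomial (Fin (n + 1)) k) = X a * X b) (dehomogenize F a) *
      HomogeneousLocalization.awayMap (grading k n) (X_mem_grading k n a)
        (mul_comm (X a) (X b))
        (dehomogenize (⟨X a, X_mem_grading k n a⟩ : grading k n 1) b) ^ d =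
    HomogeneousLocalization.awayMap (grading k n) (X_mem_grading k n a)
        (mul_comm (X a) (X b)) (dehomogenize F b) := by
  simp only [dehomogenize, HomogeneousLocalization.awayMap_mk]
  ext
  rw [HomogeneousLocalization.val_mul, HomogeneousLocalization.val_pow,
    HomogeneousLocalization.Away.val_mk,
    HomogeneousLocalization.Away.val_mk, HomogeneousLocalization.Away.val_mk, Localization.mk_pow,
    Localization.mk_mul,
    Localization.mk_eq_mk_iff, Localization.r_iff_exists]
  exact ⟨1, by simp; ring⟩

/-- Gluing on overlaps: multiplying numerator and denominator by a power of `u_a` puts the numerator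
in `I`. The same numerator then gives an element of the ideal on `D₊(u_b)`, and on the overlap the
two fractions differ by a power of the unit `u_a / u_b`. -/
lemma map_awayMap_eq_zero {R : Type*} [CommRing R] (I : Ideal (MvPolynomial (Fin (n + 1)) k))
    (a b : Fin (n + 1))
    (θ : HomogeneousLocalization.Away (grading k n) (X a * X b) →+* R)
    (hθ : ∀ w ∈ localIdeal I b, θ (HomogeneousLocalization.awayMap (grading k n)
      (X_mem_grading k n a) (mul_comm (X a) (X b)) w) = 0)
    (z : Chart k n a) (hz : z ∈ localIdeal I a) :
    θ (HomogeneousLocalization.awayMap (grading k n) (X_mem_grading k n b) rfl z) = 0 := by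
  obtain ⟨d, F, rfl⟩ := dehomogenize_surjective a z
  obtain ⟨m, hm⟩ := (dehomogenize_mem_localIdeal_iff I F a).1 hz
  have hF : X a ^ m * F.1 ∈ grading k n (m + d) := by
    have := SetLike.mul_mem_graded (SetLike.pow_mem_graded m (X_mem_grading k n a)) F.2
    simpa using this
  have hdeh : dehomogenize F a = dehomogenize (⟨_, hF⟩ : grading k n (m + d)) a := by
    apply HomogeneousLocalization.val_injective
    rw [dehomogenize, dehomogenize, HomogeneousLocalization.Away.val_mk,
      HomogeneousLocalization.Away.val_mk,
      Localization.mk_eq_mk_iff, Localization.r_iff_exists]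
    exact ⟨1, by simp; ring⟩
  have hmul := congr(θ $(awayMap_dehomogenize_mul (⟨_, hF⟩ : grading k n (m + d)) a b))
  rw [hθ _ ((dehomogenize_mem_localIdeal_iff _ _ _).2 ⟨0, by simpa using hm⟩), map_mul] at hmul
  rw [hdeh]
  exact ((((isUnit_awayMap_ratio a b).pow (m + d)).map θ).mul_left_eq_zero).1 hmul

/-- The part in the chart `D₊(u_b)` of the closed subscheme defined by a homogeneous ideal. -/
abbrev chartMap (I : Ideal (MvPolynomial (Fin (n + 1)) k)) (b : Fin (n + 1)) :
    Spec (CommRingCat.of (Chart k n b ⧸ localIdeal I b)) ⟶ projSpace k n :=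
  Spec.map (CommRingCat.ofHom (Ideal.Quotient.mk (localIdeal I b))) ≫
    Proj.awayι (grading k n) (X b) (X_mem_grading k n b) Nat.one_pos

lemma top_le_chartMap_preimage (I : Ideal (MvPolynomial (Fin (n + 1)) k)) (b : Fin (n + 1)) :
    ⊤ ≤ chartMap I b ⁻¹ᵁ Proj.basicOpen (grading k n) (X b) := by
  rw [← Proj.opensRange_awayι _ _ (X_mem_grading k n b) Nat.one_pos]; simp

lemma awayToSection_appLE_chartMap (I : Ideal (MvPolynomial (Fin (n + 1)) k)) (b : Fin (n + 1)) :
    Proj.awayToSection (grading k n) (X b) ≫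
      (chartMap I b).appLE (Proj.basicOpen (grading k n) (X b)) ⊤ (top_le_chartMap_preimage I b) =
      CommRingCat.ofHom (Ideal.Quotient.mk (localIdeal I b)) ≫ (Scheme.ΓSpecIso _).inv := by
  have h' : ⊤ ≤ Proj.awayι (grading k n) (X b) (X_mem_grading k n b) Nat.one_pos ⁻¹ᵁ
      Proj.basicOpen (grading k n) (X b) := by
    rw [← Proj.opensRange_awayι _ _ (X_mem_grading k n b) Nat.one_pos]; simp
  rw [← Scheme.Hom.appLE_comp_appLE _ _ _ ⊤ ⊤ h' le_rfl, ← Category.assoc,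
    awayToSection_appLE_awayι, Scheme.ΓSpecIso_inv_naturality]
  rw [Scheme.Hom.appTop, Scheme.Hom.app_eq_appLE]
  rfl

lemma mem_localIdeal_of_chartMap_app_eq_zero (I : Ideal (MvPolynomial (Fin (n + 1)) k))
    (a : Fin (n + 1)) (z : Chart k n a)
    (hz : ((chartMap I a).app (Proj.basicOpen (grading k n) (X a))).hom
      ((Proj.awayToSection (grading k n) (X a)).hom z) = 0) : z ∈ localIdeal I a := by
  have h2 := congr($(awayToSection_appLE_chartMap I a) z)
  rw [Scheme.Hom.appLE, CommRingCat.comp_apply, CommRingCat.comp_apply,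
    CommRingCat.comp_apply] at h2
  erw [hz] at h2
  rw [map_zero] at h2
  have h3 := congr((Scheme.ΓSpecIso _).hom $h2)
  rw [map_zero, Iso.inv_hom_id_apply] at h3
  exact Ideal.Quotient.eq_zero_iff_mem.1 h3.symm

/-- The piece in `D₊(u_b)` meets `D₊(u_a)` only inside `D₊(u_a u_b)`, so the vanishing can be tested
on the overlap. -/
lemma chartMap_app_eq_zero (I : Ideal (MvPolynomial (Fin (n + 1)) k))
    (a b : Fin (n + 1)) (z : Chart k n a) (hz : z ∈ localIdeal I a) :
    ((chartMap I b).app (Proj.basicOpen (grading k n) (X a))).hom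
      ((Proj.awayToSection (grading k n) (X a)).hom z) = 0 := by
  have hW : chartMap I b ⁻¹ᵁ Proj.basicOpen (grading k n) (X a) ≤
      chartMap I b ⁻¹ᵁ Proj.basicOpen (grading k n) (X a * X b) := by
    rw [Proj.basicOpen_mul]
    exact fun x hx => ⟨hx, top_le_chartMap_preimage I b trivial⟩
  have hb : CommRingCat.ofHom (HomogeneousLocalization.awayMap (grading k n)
        (X_mem_grading k n a) (mul_comm (X a) (X b))) ≫
      Proj.awayToSection (grading k n) (X a * X b) ≫ (chartMap I b).appLE _ _ hW =
      CommRingCat.ofHom (Ideal.Quotient.mk (localIdeal I b)) ≫ (Scheme.ΓSpecIso _).inv ≫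
        (Spec _).presheaf.map (homOfLE le_top).op := by
    rw [← Category.assoc (CommRingCat.ofHom (Ideal.Quotient.mk (localIdeal I b))),
      ← awayToSection_appLE_chartMap, Category.assoc, Scheme.Hom.appLE_map, ← Category.assoc,
      Proj.awayMap_awayToSection, Category.assoc, Scheme.Hom.map_appLE]
  have ha : CommRingCat.ofHom (HomogeneousLocalization.awayMap (grading k n)
        (X_mem_grading k n b) rfl) ≫
      Proj.awayToSection (grading k n) (X a * X b) ≫ (chartMap I b).appLE _ _ hW =
      Proj.awayToSection (grading k n) (X a) ≫ (chartMap I b).app _ := by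
    rw [← Category.assoc, Proj.awayMap_awayToSection, Category.assoc, Scheme.Hom.map_appLE,
      Scheme.Hom.app_eq_appLE]
  refine (congr($ha z)).symm.trans (map_awayMap_eq_zero I a b
    (Proj.awayToSection (grading k n) (X a * X b) ≫ (chartMap I b).appLE _ _ hW).hom ?_ z hz)
  intro w hw
  refine (congr($hb w)).trans ?_
  have hw' : CommRingCat.ofHom (Ideal.Quotient.mk (localIdeal I b)) w = 0 :=
    Ideal.Quotient.eq_zero_iff_mem.2 hw
  rw [CommRingCat.comp_apply, hw', map_zero]

/-- In the infimum over all charts, the term of the chart itself already gives the local ideal. The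
other terms impose nothing further, because the pieces agree on overlaps. -/
lemma chartIdeal_idealSheaf (I : Ideal (MvPolynomial (Fin (n + 1)) k)) (a : Fin (n + 1)) :
    chartIdeal (idealSheaf I) a = localIdeal I a := by
  ext z
  rw [chartIdeal, idealSheaf, Scheme.IdealSheafData.ideal_iInf, Ideal.mem_comap, iInf_apply,
      Ideal.mem_iInf]
  constructor
  · intro hz
    exact mem_localIdeal_of_chartMap_app_eq_zero I a z (Scheme.Hom.ideal_ker_le _ _ (hz a))
  · intro hz b
    rw [Scheme.Hom.ker_apply, RingHom.mem_ker]
    exact chartMap_app_eq_zero I a b z hz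

lemma dehomogenize_mem_chartIdeal_iff (I : Ideal (MvPolynomial (Fin (n + 1)) k))
    {d : ℕ} (F : grading k n d) (a : Fin (n + 1)) :
    dehomogenize F a ∈ chartIdeal (idealSheaf I) a ↔ ∃ m, X a ^ m * F.1 ∈ I := by
  rw [chartIdeal_idealSheaf, dehomogenize_mem_localIdeal_iff]

lemma idealSheaf_mono {I J : Ideal (MvPolynomial (Fin (n + 1)) k)} (h : I ≤ J) :
    idealSheaf I ≤ idealSheaf J := by
  refine iInf_mono fun a => ?_
  have hle : localIdeal I a ≤ localIdeal J a := Ideal.comap_mono (Ideal.map_mono h)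
  have hcomp : chartMap J a = Spec.map (CommRingCat.ofHom (Ideal.Quotient.factor hle)) ≫
      chartMap I a := by
    rw [chartMap, chartMap, ← Category.assoc, ← Spec.map_comp, ← CommRingCat.ofHom_comp,
      Ideal.Quotient.factor_comp_mk]
  change (chartMap I a).ker ≤ (chartMap J a).ker
  rw [hcomp]
  exact Scheme.Hom.le_ker_comp _ _

/-! ### Generation of the ideal of the rational normal curve by minors. -/

variable (k) in
/-- The coordinate `u_i` of `ℙⁿ`, or `0` if `i > n`. -/
def coord (n i : ℕ) : MvPolynomial (Fin (n + 1)) k :=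
  if h : i < n + 1 then X ⟨i, h⟩ else 0

@[simp] lemma coord_val (i : Fin (n + 1)) : coord k n i = X i := by
  simp [coord, i.2]

lemma coord_mem (i : ℕ) : coord k n i ∈ grading k n 1 := by
  unfold coord
  split_ifs
  · exact X_mem_grading k n _
  · exact zero_mem _

lemma veronese_coord {i : ℕ} (hi : i ≤ n) :
    veronese k n (coord k n i) = X 0 ^ i * X 1 ^ (n - i) := by
  simp [coord, Nat.lt_succ_of_le hi, veronese, veroneseMonomial]

variable (k) in
/-- The minors of the matrix with rows `u_0, …, u_{n-1}` and `u_1, …, u_n`. -/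
def minor (n i j : ℕ) : MvPolynomial (Fin (n + 1)) k :=
  coord k n i * coord k n (j + 1) - coord k n (i + 1) * coord k n j

lemma minor_mem (i j : ℕ) : minor k n i j ∈ grading k n 2 :=
  sub_mem (SetLike.mul_mem_graded (coord_mem _) (coord_mem _))
    (SetLike.mul_mem_graded (coord_mem _) (coord_mem _))

lemma veronese_minor {i j : ℕ} (hi : i < n) (hj : j < n) : veronese k n (minor k n i j) = 0 := by
  rw [minor, map_sub, map_mul, map_mul, veronese_coord hi.le, veronese_coord hj.le,
    veronese_coord (show i + 1 ≤ n from hi), veronese_coord (show j + 1 ≤ n from hj)]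
  obtain ⟨a, rfl⟩ := Nat.exists_eq_add_of_lt hi
  obtain ⟨b, hb⟩ := Nat.exists_eq_add_of_lt hj
  rw [show i + a + 1 - i = a + 1 by omega, show i + a + 1 - (i + 1) = a by omega,
    show i + a + 1 - j = b + 1 by omega, show i + a + 1 - (j + 1) = b by omega]
  ring

variable (k) in
/-- The forms of degree `d` in the ideal generated by the minors. -/
def minorSpan (n d : ℕ) : Submodule k (MvPolynomial (Fin (n + 1)) k) :=
  Submodule.span k {F | ∃ e i j, ∃ H ∈ grading k n e, e + 2 = d ∧ i < n ∧ j < n ∧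
    F = H * minor k n i j}

lemma mul_minor_mem {e i j : ℕ} {H : MvPolynomial (Fin (n + 1)) k} (hH : H ∈ grading k n e)
    (hi : i < n) (hj : j < n) : H * minor k n i j ∈ minorSpan k n (e + 2) :=
  Submodule.subset_span ⟨e, i, j, H, hH, rfl, hi, hj, rfl⟩

lemma mul_mem_minorSpan {d e : ℕ} {G F : MvPolynomial (Fin (n + 1)) k} (hG : G ∈ grading k n e)
    (hF : F ∈ minorSpan k n d) : G * F ∈ minorSpan k n (d + e) := by
  induction hF using Submodule.span_induction with
  | mem x hx =>
    obtain ⟨e', i, j, H, hH, rfl, hi, hj, rfl⟩ := hx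
    rw [← mul_assoc, show e' + 2 + e = (e + e') + 2 by omega]
    exact mul_minor_mem (SetLike.mul_mem_graded hG hH) hi hj
  | zero => simp
  | add x y _ _ hx hy => rw [mul_add]; exact add_mem hx hy
  | smul c x _ hx => rw [mul_smul_comm]; exact Submodule.smul_mem _ _ hx

/-- Telescoping: shifting one unit of index from one factor to the other costs a single minor. -/
lemma mul_coord_sub_mem_aux {e : ℕ} {H : MvPolynomial (Fin (n + 1)) k} (hH : H ∈ grading k n e)
    (c : ℕ) : ∀ i j : ℕ, i + c ≤ n → j + c ≤ n →
      H * (coord k n i * coord k n (j + c) - coord k n (i + c) * coord k n j) ∈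
        minorSpan k n (e + 2) := by
  induction c with
  | zero => intro i j _ _; simp
  | succ c ih =>
    intro i j hi hj
    have h1 := mul_minor_mem hH (show i < n by omega) (show j + c < n by omega)
    have h2 := ih (i + 1) j (by omega) (by omega)
    convert add_mem h1 h2 using 1
    rw [minor, show i + 1 + c = i + (c + 1) by omega, show j + c + 1 = j + (c + 1) by omega]
    ring

lemma mul_coord_sub_mem {e : ℕ} {H : MvPolynomial (Fin (n + 1)) k} (hH : H ∈ grading k n e)
    {i j i' j' : ℕ} (hi : i ≤ n) (hj : j ≤ n) (hi' : i' ≤ n) (hj' : j' ≤ n)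
    (h : i + j = i' + j') :
    H * (coord k n i * coord k n j - coord k n i' * coord k n j') ∈ minorSpan k n (e + 2) := by
  rcases le_total i i' with h1 | h1
  · obtain ⟨c, rfl⟩ := Nat.exists_eq_add_of_le h1
    obtain rfl : j = j' + c := by omega
    exact mul_coord_sub_mem_aux hH c _ _ hi' hj
  · obtain ⟨c, rfl⟩ := Nat.exists_eq_add_of_le h1
    obtain rfl : j' = j + c := by omega
    have := neg_mem (mul_coord_sub_mem_aux hH c _ _ hi hj')
    convert this using 1
    ring

variable (k) in
/-- A monomial of degree `d` that the Veronese map sends to `x₀ ^ w * x₁ ^ (n * d - w)`. -/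
def normalMonomial (n : ℕ) : ℕ → ℕ → MvPolynomial (Fin (n + 1)) k
  | 0, _ => 1
  | d + 1, w => coord k n (min w n) * normalMonomial n d (w - min w n)

lemma normalMonomial_mem (d w : ℕ) : normalMonomial k n d w ∈ grading k n d := by
  induction d generalizing w with
  | zero => exact SetLike.one_mem_graded _
  | succ d ih =>
    rw [normalMonomial, Nat.add_comm d 1]
    exact SetLike.mul_mem_graded (coord_mem _) (ih _)

lemma veronese_normalMonomial (d w : ℕ) (hw : w ≤ n * d) :
    veronese k n (normalMonomial k n d w) = X 0 ^ w * X 1 ^ (n * d - w) := by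
  induction d generalizing w with
  | zero => obtain rfl : w = 0 := by omega
            simp [normalMonomial]
  | succ d ih =>
    rw [Nat.mul_succ] at hw ⊢
    rw [normalMonomial, map_mul, veronese_coord (min_le_right _ _), ih _ (by omega)]
    rw [mul_mul_mul_comm, ← pow_add, ← pow_add]
    congr 2 <;> omega

lemma coord_mul_normalMonomial_sub_mem (d : ℕ) : ∀ i w : ℕ, i ≤ n → w ≤ n * d →
    coord k n i * normalMonomial k n d w - normalMonomial k n (d + 1) (w + i) ∈
      minorSpan k n (d + 1) := by
  induction d with
  | zero =>
    intro i w hi hw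
    obtain rfl : w = 0 := by omega
    simp [normalMonomial, hi]
  | succ d ih =>
    intro i w hi hw
    rw [Nat.mul_succ] at hw
    have hN := normalMonomial_mem (k := k) (n := n) d
    -- it suffices to exchange the first two coordinates
    have main : ∀ c c' r w' : ℕ, c ≤ n → c' ≤ n → r ≤ n → w' ≤ n * d → i + c = c' + r →
        coord k n i * (coord k n c * normalMonomial k n d w') -
          coord k n c' * normalMonomial k n (d + 1) (w' + r) ∈ minorSpan k n (d + 1 + 1) := by
      intro c c' r w' hc hc' hr hw' h
      have h1 := mul_coord_sub_mem (hN w') hi hc hc' hr h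
      have h2 := mul_mem_minorSpan (coord_mem (k := k) (n := n) c') (ih r w' hr hw')
      convert add_mem h1 h2 using 1
      ring
    rw [normalMonomial, normalMonomial.eq_def k n (d + 1 + 1)]
    dsimp only
    -- If the leading factor is `u_n`, it stays and `u_i` is passed on to the tail. Otherwise the
    -- tail has weight 0, and `u_w u_i` becomes `u_(w+i) u_0` or `u_n u_(w+i-n)`.
    rcases le_total n w with h | h
    · have := main n n i (w - n) le_rfl le_rfl hi (by omega) (by omega)
      rw [min_eq_right h, min_eq_right (by omega : n ≤ w + i)]
      rwa [show w + i - n = w - n + i by omega]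
    · rw [min_eq_left h, Nat.sub_self]
      rcases le_total (w + i) n with h' | h'
      · have := main w (w + i) 0 0 h h' (by omega) (by omega) (by omega)
        rwa [min_eq_left h', Nat.sub_self]
      · have := main w n (w + i - n) 0 h le_rfl (by omega) (by omega) (by omega)
        rw [min_eq_right h']
        rwa [zero_add] at this

lemma monomial_sub_normalMonomial_mem (d : ℕ) : ∀ s : Fin (n + 1) →₀ ℕ, s.degree = d →
    ∃ w ≤ n * d, veronese k n (monomial s 1) = X 0 ^ w * X 1 ^ (n * d - w) ∧
      monomial s 1 - normalMonomial k n d w ∈ minorSpan k n d := by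
  induction d with
  | zero =>
    intro s hs
    rw [Finsupp.degree_eq_zero_iff] at hs
    subst hs
    exact ⟨0, by simp, by simp [veronese], by simp [normalMonomial]⟩
  | succ d ih =>
    intro s hs
    obtain ⟨i, hi⟩ : ∃ i, s i ≠ 0 := by
      by_contra! h
      have : s = 0 := Finsupp.ext h
      simp [this] at hs
    have hle : Finsupp.single i 1 ≤ s := by
      rw [Finsupp.single_le_iff]; omega
    obtain ⟨t, rfl⟩ := exists_add_of_le hle
    have ht : t.degree = d := by
      rw [map_add, Finsupp.degree_single] at hs; omega
    obtain ⟨w, hw, h1, h2⟩ := ih t ht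
    have hmul : (monomial (Finsupp.single i 1 + t) (1 : k)) = coord k n i * monomial t 1 := by
      rw [coord_val, X, monomial_mul, one_mul]
    have hin : (i : ℕ) ≤ n := Nat.le_of_lt_succ i.2
    have h3 := coord_mul_normalMonomial_sub_mem (k := k) d i w hin hw
    refine ⟨w + i, by rw [Nat.mul_succ]; omega, ?_, ?_⟩
    · rw [hmul, map_mul, h1, veronese_coord hin, mul_mul_mul_comm, ← pow_add, ← pow_add,
        Nat.mul_succ]
      congr 2 <;> omega
    · rw [hmul]
      convert add_mem (mul_mem_minorSpan (coord_mem (k := k) (n := n) i) h2) h3 using 1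
      ring

/-- The forms vanishing on the rational normal curve are generated by the minors. -/
lemma mem_minorSpan_of_veronese_eq_zero {d : ℕ} {F : MvPolynomial (Fin (n + 1)) k}
    (hF : F ∈ grading k n d) (h : veronese k n F = 0) : F ∈ minorSpan k n d := by
  -- `τ` is a linear section of the Veronese map in degree `d` with values in normal monomials.
  -- Modulo minors every form `F` of degree `d` equals `τ` of its restriction, which is zero here.
  let τ : MvPolynomial (Fin 2) k →ₗ[k] MvPolynomial (Fin (n + 1)) k :=
    (basisMonomials (Fin 2) k).constr k fun s => normalMonomial k n d (s 0)
  have hτ : ∀ s : Fin 2 →₀ ℕ, τ (monomial s 1) = normalMonomial k n d (s 0) := by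
    intro s
    have := (basisMonomials (Fin 2) k).constr_basis k
      (fun s => normalMonomial k n d (s 0)) s
    rwa [coe_basisMonomials] at this
  have key : F - τ (veronese k n F) ∈ minorSpan k n d := by
    rw [show F - τ (veronese k n F) = ∑ s ∈ F.support, (monomial s (coeff s F) -
        τ (veronese k n (monomial s (coeff s F)))) by
      rw [Finset.sum_sub_distrib, ← map_sum, ← map_sum, ← F.as_sum]]
    refine Submodule.sum_mem _ fun s hs => ?_
    have hd : s.degree = d := by
      have := (mem_homogeneousSubmodule _ _).1 hF (mem_support_iff.1 hs)
      rwa [Finsupp.degree_eq_weight_one]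
    obtain ⟨w, hw, h1, h2⟩ := monomial_sub_normalMonomial_mem (k := k) d s hd
    have h3 : (monomial s (coeff s F)) = coeff s F • monomial s (1 : k) := by
      simp [smul_monomial]
    have h4 : (X 0 ^ w * X 1 ^ (n * d - w) : MvPolynomial (Fin 2) k) =
        monomial (Finsupp.single 0 w + Finsupp.single 1 (n * d - w)) 1 := by
      simp [X_pow_eq_monomial, monomial_mul]
    rw [h3, map_smul, map_smul, ← smul_sub, h1, h4, hτ]
    refine Submodule.smul_mem _ _ ?_
    simpa using h2
  simpa [h] using key

/-! ### Linear algebra of symmetric tensors and contraction. -/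

section SymmTensors

variable {V W : Type u} [AddCommGroup V] [Module k V] [AddCommGroup W] [Module k W]
  {ι : Type*}

lemma tensorMatrix_transpose_of_mem_symmTensors (b : Module.Basis ι k V) {q : V ⊗[k] V}
    (hq : q ∈ symmTensors (k := k) V) (i j : ι) :
    tensorMatrix b q i j = tensorMatrix b q j i := by
  have h : ∀ q : V ⊗[k] V, (b.tensorProduct b).repr (TensorProduct.comm k V V q) (i, j) =
      (b.tensorProduct b).repr q (j, i) := by
    intro q
    induction q with
    | zero => simp
    | tmul x y => simp [mul_comm]
    | add x y hx hy => simp [hx, hy]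
  have h' : TensorProduct.comm k V V q = q := hq
  have := h q
  rw [h'] at this
  exact this

lemma eq_sum_tensorMatrix [Fintype ι] (b : Module.Basis ι k V) (q : V ⊗[k] V) :
    q = ∑ i, ∑ j, tensorMatrix b q i j • (b i ⊗ₜ[k] b j) := by
  conv_lhs => rw [← (b.tensorProduct b).sum_repr q]
  rw [Fintype.sum_prod_type]
  simp [tensorMatrix]

/-- A linear map that is alternating on a basis kills the symmetric tensors. -/
lemma map_eq_zero_of_mem_symmTensors [Fintype ι] [DecidableEq ι] (b : Module.Basis ι k V)
    (D : V ⊗[k] V →ₗ[k] W)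
    (h₁ : ∀ i, D (b i ⊗ₜ b i) = 0) (h₂ : ∀ i j, D (b i ⊗ₜ b j) + D (b j ⊗ₜ b i) = 0)
    {q : V ⊗[k] V} (hq : q ∈ symmTensors (k := k) V) : D q = 0 := by
  rw [eq_sum_tensorMatrix b q, map_sum]
  simp only [map_sum, map_smul]
  rw [← Fintype.sum_prod_type' (f := fun i j => tensorMatrix b q i j • D (b i ⊗ₜ b j))]
  -- The terms `(i, j)` and `(j, i)` cancel. The diagonal is killed by its own hypothesis, so
  -- characteristic 2 needs no exception.
  refine Finset.sum_involution (fun p _ => p.swap) ?_ ?_ (by simp) (by simp)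
  · rintro ⟨i, j⟩ _
    dsimp
    rw [tensorMatrix_transpose_of_mem_symmTensors b hq j i, ← smul_add, h₂, smul_zero]
  · rintro ⟨i, j⟩ _ h heq
    simp only [Prod.swap_prod_mk, Prod.mk.injEq] at heq
    rw [heq.1, h₁, smul_zero] at h
    exact h rfl

lemma tmul_self_mem_symmTensors (x : V) : x ⊗ₜ x ∈ symmTensors (k := k) V := by
  simp [symmTensors]

lemma tmul_add_tmul_mem_symmTensors (x y : V) :
    x ⊗ₜ y + y ⊗ₜ x ∈ symmTensors (k := k) V := by
  simp [symmTensors, add_comm]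

lemma contract_eq_sum [Fintype ι] (b : Module.Basis ι k V) (lam : Module.Dual k V) (q : V ⊗[k] V) :
    contract lam q = ∑ j, (∑ i, tensorMatrix b q i j * lam (b i)) • b j := by
  conv_lhs => rw [eq_sum_tensorMatrix b q]
  simp only [map_sum, map_smul, contract, LinearMap.comp_apply, LinearMap.rTensor_tmul,
    LinearEquiv.coe_coe, TensorProduct.lid_tmul]
  rw [Finset.sum_comm]
  simp [Finset.sum_smul, mul_smul]

lemma contract_tmul (lam : Module.Dual k V) (x y : V) :
    contract lam (x ⊗ₜ y) = lam x • y := by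
  simp [contract]

lemma repr_contract_coord (b : Module.Basis ι k V) (q : V ⊗[k] V) (i j : ι) :
    b.repr (contract (b.coord i) q) j = tensorMatrix b q i j := by
  induction q with
  | zero => simp [tensorMatrix]
  | tmul x y => simp [contract_tmul, tensorMatrix, mul_comm]
  | add x y hx hy => simp_all [tensorMatrix]

lemma exists_contract_eq (lam : Module.Dual k V) (hlam : lam ≠ 0) (v : V) :
    ∃ q ∈ symmTensors (k := k) V, contract lam q = v := by
  obtain ⟨w, hw⟩ : ∃ w, lam w ≠ 0 := by
    by_contra! h
    exact hlam (LinearMap.ext h)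
  obtain ⟨w, hw⟩ : ∃ w, lam w = 1 := ⟨(lam w)⁻¹ • w, by simp [hw]⟩
  -- With `λ(w) = 1` the symmetrised product contracts to `v + λ(v) w`. The correction term removes
  -- the excess without dividing by 2.
  refine ⟨(w ⊗ₜ v + v ⊗ₜ w) - lam v • (w ⊗ₜ w), sub_mem (tmul_add_tmul_mem_symmTensors w v)
    (Submodule.smul_mem _ _ (tmul_self_mem_symmTensors w)), ?_⟩
  simp [contract_tmul, hw]

/-- By symmetry, contracting with `λ` is multiplying the matrix of `q` by the vector of values of
`λ` on the basis. Every vector arises from a unique `λ`. -/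
lemma exists_contract_eq_zero_iff_det_eq_zero [Fintype ι] [DecidableEq ι]
    (b : Module.Basis ι k V) {q : V ⊗[k] V}
    (hq : q ∈ symmTensors (k := k) V) :
    (∃ lam : Module.Dual k V, lam ≠ 0 ∧ contract lam q = 0) ↔ (tensorMatrix b q).det = 0 := by
  have hc (lam : Module.Dual k V) :
      contract lam q = 0 ↔ (tensorMatrix b q).mulVec (fun i => lam (b i)) = 0 := by
    rw [contract_eq_sum b]
    constructor
    · intro h
      have := Fintype.linearIndependent_iff.1 b.linearIndependent _ h
      funext j
      rw [Matrix.mulVec, dotProduct, Pi.zero_apply, ← this j]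
      exact Finset.sum_congr rfl fun i _ => by
        rw [tensorMatrix_transpose_of_mem_symmTensors b hq]
    · intro h
      refine Finset.sum_eq_zero fun j _ => ?_
      have := congrFun h j
      rw [Matrix.mulVec, dotProduct, Pi.zero_apply] at this
      rw [Finset.sum_congr rfl fun i _ => by
        rw [tensorMatrix_transpose_of_mem_symmTensors b hq], this, zero_smul]
  rw [← Matrix.exists_mulVec_eq_zero_iff]
  constructor
  · rintro ⟨lam, h0, h⟩
    refine ⟨_, fun h' => h0 (b.ext fun i => ?_), (hc lam).1 h⟩
    exact congrFun h' i
  · rintro ⟨v, h0, h⟩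
    refine ⟨b.constr k v, fun h' => h0 ?_, (hc _).2 ?_⟩
    · funext i
      rw [← b.constr_basis k v i, h']
      rfl
    · simpa using h

end SymmTensors

/-! ### Binary forms and the quadrics attached to tensors. -/

lemma isHomogeneous_pow_mul_pow (p q : ℕ) :
    (X 0 ^ p * X 1 ^ q : MvPolynomial (Fin 2) k).IsHomogeneous (p + q) :=
  (isHomogeneous_X_pow _ _).mul (isHomogeneous_X_pow _ _)

lemma pow_mul_pow_eq_monomial (p q : ℕ) : (X 0 ^ p * X 1 ^ q : MvPolynomial (Fin 2) k) =
    monomial (Finsupp.single 0 p + Finsupp.single 1 q) 1 := by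
  simp [X_pow_eq_monomial, monomial_mul]

lemma single_add_single_injective {p q p' q' : ℕ} :
    (Finsupp.single 0 p + Finsupp.single 1 q : Fin 2 →₀ ℕ) =
      Finsupp.single 0 p' + Finsupp.single 1 q' ↔ p = p' ∧ q = q' := by
  constructor
  · intro h
    exact ⟨by simpa using DFunLike.congr_fun h 0, by simpa using DFunLike.congr_fun h 1⟩
  · rintro ⟨rfl, rfl⟩; rfl

/-- A binary form of degree `d` is a combination of the monomials `x₀ ^ p * x₁ ^ q`, `p + q = d`. -/
lemma form_mem_span {d : ℕ} {f : MvPolynomial (Fin 2) k} (hf : f.IsHomogeneous d) :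
    f ∈ Submodule.span k {g | ∃ p q, p + q = d ∧ g = X 0 ^ p * X 1 ^ q} := by
  rw [f.as_sum]
  refine Submodule.sum_mem _ fun s hs => ?_
  have hd := hf (mem_support_iff.1 hs)
  replace hd : s.degree = d := by rwa [Finsupp.degree_eq_weight_one]
  rw [Finsupp.degree_eq_sum, Fin.sum_univ_two] at hd
  have hs' : s = Finsupp.single 0 (s 0) + Finsupp.single 1 (s 1) := by
    ext i; fin_cases i <;> simp
  have : monomial s (coeff s f) = coeff s f • (X 0 ^ (s 0) * X 1 ^ (s 1)) := by
    rw [pow_mul_pow_eq_monomial, ← hs', smul_monomial, smul_eq_mul, mul_one]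
  rw [this]
  exact Submodule.smul_mem _ _ (Submodule.subset_span ⟨_, _, hd, rfl⟩)

variable (k) in
/-- The monomial basis of `H⁰(ℙ¹, 𝒪(n - 2))`. -/
def monomialBasis (n : ℕ) (hn : 2 ≤ n) : Module.Basis (Fin (n - 1)) k (Forms k (n - 2)) :=
  Module.Basis.mk (v := monomialForm k n)
    (by
      rw [Fintype.linearIndependent_iff]
      intro c hc i
      have h := congr(coeff (Finsupp.single 0 (i : ℕ) + Finsupp.single 1 (n - 2 - (i : ℕ)))
        (Subtype.val $hc))
      rw [AddSubmonoidClass.coe_finsetSum, coeff_sum, Finset.sum_eq_single i] at h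
      · simpa [monomialForm, pow_mul_pow_eq_monomial] using h
      · intro j _ hj
        simp only [Submodule.coe_smul, monomialForm, pow_mul_pow_eq_monomial, coeff_smul,
          coeff_monomial]
        rw [if_neg, smul_zero]
        rw [single_add_single_injective]
        exact fun h => hj (Fin.ext h.1)
      · simp)
    (by
      rintro ⟨f, hf⟩ -
      have h := form_mem_span ((mem_homogeneousSubmodule _ _).1 hf)
      suffices h' : f ∈ (Submodule.span k (Set.range (monomialForm k n))).map
          (homogeneousSubmodule (Fin 2) k (n - 2)).subtype by
        obtain ⟨g, hg, rfl⟩ := h'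
        exact hg
      rw [Submodule.map_span]
      refine Submodule.span_mono ?_ h
      rintro g ⟨p, q, hpq, rfl⟩
      refine ⟨monomialForm k n ⟨p, by omega⟩, ⟨_, rfl⟩, ?_⟩
      simp only [monomialForm, Submodule.subtype_apply]
      congr 2
      omega)

@[simp] lemma monomialBasis_apply (hn : 2 ≤ n) (i : Fin (n - 1)) :
    monomialBasis k n hn i = monomialForm k n i := by
  simp [monomialBasis]

lemma toLinearForm_pow_mul_pow {p q : ℕ} (h : p + q = n) :
    toLinearForm n (X 0 ^ p * X 1 ^ q : MvPolynomial (Fin 2) k) = coord k n p := by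
  have hp : p < n + 1 := by omega
  rw [toLinearForm, LinearMap.sum_apply, Finset.sum_eq_single ⟨p, hp⟩]
  · simp only [LinearMap.smulRight_apply, lcoeff_apply, pow_mul_pow_eq_monomial]
    rw [show n - p = q by omega, coeff_monomial, if_pos rfl, one_smul, coord, dif_pos hp]
  · intro j _ hj
    simp only [LinearMap.smulRight_apply, lcoeff_apply, pow_mul_pow_eq_monomial]
    rw [coeff_monomial, if_neg, zero_smul]
    rw [single_add_single_injective]
    exact fun h => hj (Fin.ext h.1.symm)
  · simp

lemma quadric_monomialForm (hn : 2 ≤ n) (i j : Fin (n - 1)) :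
    (quadric n (monomialForm k n i ⊗ₜ monomialForm k n j)).1 =
      coord k n (i + 2) * coord k n j - coord k n (i + 1) * coord k n (j + 1) := by
  have hi := i.2
  have hj := j.2
  simp only [quadric, TensorProduct.lift.tmul, LinearMap.mk₂_apply, monomialForm]
  congr 2
  · rw [← toLinearForm_pow_mul_pow (show (i : ℕ) + 2 + (n - 2 - i) = n by omega)]
    congr 1; ring
  · rw [← toLinearForm_pow_mul_pow (show (j : ℕ) + (n - 2 - j + 2) = n by omega)]
    congr 1; ring
  · rw [← toLinearForm_pow_mul_pow (show (i : ℕ) + 1 + (n - 2 - i + 1) = n by omega)]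
    congr 1; ring
  · rw [← toLinearForm_pow_mul_pow (show (j : ℕ) + 1 + (n - 2 - j + 1) = n by omega)]
    congr 1; ring

/-- Every minor comes from a symmetric tensor. -/
lemma exists_quadric_eq_minor (hn : 2 ≤ n) (c : ℕ) : ∀ i : ℕ, i + c < n →
    ∃ q ∈ symmTensors (k := k) (Forms k (n - 2)), (quadric n q).1 = minor k n i (i + c) := by
  induction c using Nat.twoStepInduction with
  | zero => intro i _; exact ⟨0, zero_mem _, by simp [minor, mul_comm]⟩
  | one =>
    intro i hi
    refine ⟨_, tmul_self_mem_symmTensors (monomialForm k n ⟨i, by omega⟩), ?_⟩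
    rw [quadric_monomialForm hn, minor]
    ring
  | more c ih _ =>
    intro i hi
    -- The quadric of the symmetrised product of the monomials with indices `i` and `i + c + 1` is
    -- the difference of the minors `(i, i + c + 2)` and `(i + 1, i + c + 1)`. Hence the induction
    -- proceeds in steps of two.
    obtain ⟨q, hq, h⟩ := ih (i + 1) (by omega)
    refine ⟨_, add_mem (tmul_add_tmul_mem_symmTensors (monomialForm k n ⟨i, by omega⟩)
      (monomialForm k n ⟨i + c + 1, by omega⟩)) hq, ?_⟩
    rw [map_add, map_add, Submodule.coe_add, Submodule.coe_add, h, quadric_monomialForm hn,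
      quadric_monomialForm hn, minor, minor]
    simp only
    rw [show i + 1 + c = i + c + 1 by omega, show i + (c + 2) = i + c + 2 by omega]
    ring

lemma exists_quadric_eq_minor' (hn : 2 ≤ n) {i j : ℕ} (hi : i < n) (hj : j < n) :
    ∃ q ∈ symmTensors (k := k) (Forms k (n - 2)), (quadric n q).1 = minor k n i j := by
  rcases le_total i j with h | h
  · obtain ⟨c, rfl⟩ := Nat.exists_eq_add_of_le h
    exact exists_quadric_eq_minor hn c i hj
  · obtain ⟨c, rfl⟩ := Nat.exists_eq_add_of_le h
    obtain ⟨q, hq, h⟩ := exists_quadric_eq_minor (k := k) hn c j hi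
    refine ⟨(-1 : k) • q, Submodule.smul_mem _ _ hq, ?_⟩
    rw [map_smul, Submodule.coe_smul, h, minor, minor, neg_smul, one_smul]
    ring

lemma exists_quadric_eq_of_veronese_eq_zero (hn : 2 ≤ n) (F : grading k n 2)
    (hF : veronese k n F.1 = 0) :
    ∃ q ∈ symmTensors (k := k) (Forms k (n - 2)), quadric n q = F := by
  have h := mem_minorSpan_of_veronese_eq_zero F.2 hF
  suffices h' : minorSpan k n 2 ≤
      ((symmTensors (k := k) (Forms k (n - 2))).map (quadric n)).map (grading k n 2).subtype by
    obtain ⟨G, ⟨q, hq, rfl⟩, hG⟩ := h' h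
    exact ⟨q, hq, Subtype.ext hG⟩
  refine Submodule.span_le.2 ?_
  rintro _ ⟨e, i, j, H, hH, he, hi, hj, rfl⟩
  -- In degree 2 the cofactors of the minors are constants, so the ideal contributes only linear
  -- combinations of minors.
  obtain rfl : e = 0 := by omega
  obtain ⟨c, rfl⟩ : ∃ c, H = C c :=
    ⟨_, totalDegree_eq_zero_iff_eq_C.1 (Nat.le_zero.1 (IsHomogeneous.totalDegree_le hH))⟩
  obtain ⟨q, hq, h⟩ := exists_quadric_eq_minor' (k := k) hn hi hj
  rw [← smul_eq_C_mul, ← h]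
  exact Submodule.smul_mem _ _ ⟨_, ⟨q, hq, rfl⟩, rfl⟩

lemma veronese_quadric (hn : 2 ≤ n) (q : Forms k (n - 2) ⊗[k] Forms k (n - 2)) :
    veronese k n (quadric n q).1 = 0 := by
  have h : (veronese k n).toLinearMap ∘ₗ (grading k n 2).subtype ∘ₗ quadric n = 0 := by
    refine ((monomialBasis k n hn).tensorProduct (monomialBasis k n hn)).ext fun ⟨i, j⟩ => ?_
    have hi := i.2
    have hj := j.2
    simp only [Module.Basis.tensorProduct_apply, monomialBasis_apply, LinearMap.comp_apply,
      Submodule.subtype_apply, quadric_monomialForm hn, AlgHom.toLinearMap_apply,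
      LinearMap.zero_apply]
    rw [map_sub, map_mul, map_mul, veronese_coord (by omega), veronese_coord (by omega),
      veronese_coord (by omega), veronese_coord (by omega), mul_mul_mul_comm, ← pow_add, ← pow_add,
      mul_mul_mul_comm, ← pow_add, ← pow_add, sub_eq_zero]
    congr 2 <;> omega
  exact LinearMap.congr_fun h q

/-! ### Conormal classes. -/

lemma pderiv_coord (l : Fin (n + 1)) (i : ℕ) :
    pderiv l (coord k n i) = if (l : ℕ) = i then 1 else 0 := by
  unfold coord
  split_ifs with h h' h'
  · obtain rfl : l = ⟨i, h⟩ := Fin.ext h'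
    simp
  · exact pderiv_X_of_ne fun h'' => h' (by rw [← h''])
  · exact absurd l.2 (by omega)
  · simp

lemma beta_eq (i : Fin (n - 1)) (l : Fin (n + 1)) :
    beta k n i l = X 0 ^ 2 * (if (l : ℕ) = i then 1 else 0) -
      2 * X 0 * X 1 * (if (l : ℕ) = i + 1 then 1 else 0) +
      X 1 ^ 2 * (if (l : ℕ) = i + 2 then 1 else 0) := by
  unfold beta
  split_ifs <;> first | omega | ring

lemma veronese_pderiv_quadric (hn : 2 ≤ n) (i j : Fin (n - 1)) (l : Fin (n + 1)) :
    veronese k n (pderiv l (quadric n (monomialForm k n i ⊗ₜ monomialForm k n j)).1) =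
      (monomialForm k n j).1 * (X 1 ^ 2 * (if (l : ℕ) = i + 2 then 1 else 0) -
        X 0 * X 1 * (if (l : ℕ) = i + 1 then 1 else 0)) +
      (monomialForm k n i).1 * (X 0 ^ 2 * (if (l : ℕ) = j then 1 else 0) -
        X 0 * X 1 * (if (l : ℕ) = j + 1 then 1 else 0)) := by
  have hi := i.2
  have hj := j.2
  rw [quadric_monomialForm hn]
  simp only [map_sub, map_mul, map_add, Derivation.leibniz, smul_eq_mul, pderiv_coord]
  rw [veronese_coord (show (i : ℕ) + 2 ≤ n by omega), veronese_coord (show (j : ℕ) ≤ n by omega),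
    veronese_coord (show (i : ℕ) + 1 ≤ n by omega), veronese_coord (show (j : ℕ) + 1 ≤ n by omega)]
  simp only [monomialForm, apply_ite (veronese k n), map_one, map_zero]
  rw [show n - ((i : ℕ) + 2) = n - 2 - i by omega, show n - (j : ℕ) = n - 2 - j + 2 by omega,
    show n - ((i : ℕ) + 1) = n - 2 - i + 1 by omega, show n - ((j : ℕ) + 1) = n - 2 - j + 1 by omega]
  ring

lemma monomialBasis_coord (hn : 2 ≤ n) (i j : Fin (n - 1)) :
    (monomialBasis k n hn).coord i (monomialForm k n j) = if j = i then 1 else 0 := by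
  rw [← monomialBasis_apply hn j, Module.Basis.coord_apply, Module.Basis.repr_self,
    Finsupp.single_apply]

/-- The conormal class of the quadric attached to a symmetric tensor. -/
lemma isConormalClass_quadric (hn : 2 ≤ n) {q : Forms k (n - 2) ⊗[k] Forms k (n - 2)}
    (hq : q ∈ symmTensors (k := k) (Forms k (n - 2))) :
    IsConormalClass (quadric n q).1
      (fun i => (contract ((monomialBasis k n hn).coord i) q).1) := by
  intro l
  -- The two sides need not agree on a product of two different monomials. Their difference `D` is
  -- alternating on the monomial basis, so it vanishes on symmetric tensors.
  let D : Forms k (n - 2) ⊗[k] Forms k (n - 2) →ₗ[k] MvPolynomial (Fin 2) k :=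
    (veronese k n).toLinearMap ∘ₗ (pderiv l).toLinearMap ∘ₗ (grading k n 2).subtype ∘ₗ quadric n -
      ∑ i, (LinearMap.mulRight k (beta k n i l)) ∘ₗ
        (homogeneousSubmodule (Fin 2) k (n - 2)).subtype ∘ₗ
          contract ((monomialBasis k n hn).coord i)
  have hD (q) : D q = veronese k n (pderiv l (quadric n q).1) -
      ∑ i, (contract ((monomialBasis k n hn).coord i) q).1 * beta k n i l := by
    simp [D, LinearMap.sum_apply]
  have hb (i j : Fin (n - 1)) : D (monomialForm k n i ⊗ₜ monomialForm k n j) =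
      veronese k n (pderiv l (quadric n (monomialForm k n i ⊗ₜ monomialForm k n j)).1) -
        (monomialForm k n j).1 * beta k n i l := by
    rw [hD]
    congr 1
    rw [Finset.sum_eq_single i]
    · rw [contract_tmul, monomialBasis_coord, if_pos rfl, one_smul]
    · intro i' _ hi'
      rw [contract_tmul, monomialBasis_coord, if_neg hi'.symm, zero_smul, Submodule.coe_zero,
        zero_mul]
    · simp
  have := map_eq_zero_of_mem_symmTensors (monomialBasis k n hn) D ?_ ?_ hq
  · rwa [hD, sub_eq_zero] at this
  · intro i
    rw [monomialBasis_apply, hb, veronese_pderiv_quadric hn, beta_eq]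
    ring
  · intro i j
    rw [monomialBasis_apply, monomialBasis_apply, hb, hb, veronese_pderiv_quadric hn,
      veronese_pderiv_quadric hn, beta_eq, beta_eq]
    ring

/-- In `d(HF) = H dF + F dH` the second term vanishes along the curve. -/
lemma IsConormalClass.mul {F H : MvPolynomial (Fin (n + 1)) k}
    {g : Fin (n - 1) → MvPolynomial (Fin 2) k} (hg : IsConormalClass F g)
    (hF : veronese k n F = 0) :
    IsConormalClass (H * F) (fun i => veronese k n H * g i) := by
  intro j
  simp [hg j, hF, Finset.mul_sum, mul_assoc]

lemma veroneseMonomial_isHomogeneous (a : Fin (n + 1)) :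
    (veroneseMonomial k n a).IsHomogeneous n := by
  have := isHomogeneous_pow_mul_pow (k := k) (a : ℕ) (n - a)
  rwa [show (a : ℕ) + (n - a) = n by omega] at this

lemma veronese_isHomogeneous {e : ℕ} {H : MvPolynomial (Fin (n + 1)) k}
    (hH : H ∈ grading k n e) : (veronese k n H).IsHomogeneous (n * e) :=
  ((mem_homogeneousSubmodule _ _).1 hH).aeval _ veroneseMonomial_isHomogeneous

/-- A form that vanishes on the rational normal curve has a conormal class. -/
lemma exists_isConormalClass (hn : 2 ≤ n) {d : ℕ} {F : MvPolynomial (Fin (n + 1)) k}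
    (hF : F ∈ grading k n d) (h : veronese k n F = 0) :
    ∃ g, IsConormalClass F g ∧ ∀ i D, D + n + 2 = n * d → (g i).IsHomogeneous D := by
  have h' := mem_minorSpan_of_veronese_eq_zero hF h
  clear hF h
  induction h' using Submodule.span_induction with
  | mem F hF =>
    obtain ⟨e, i, j, H, hH, rfl, hi, hj, rfl⟩ := hF
    obtain ⟨q, hq, h⟩ := exists_quadric_eq_minor' (k := k) hn hi hj
    rw [← h]
    refine ⟨_, (isConormalClass_quadric hn hq).mul (veronese_quadric hn q), ?_⟩
    intro i D hD
    -- A form of degree `d` has conormal coordinates in `𝒪(nd - n - 2)`. For a multiple of a minor,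
    -- with `d = e + 2`, this degree is `ne + (n - 2)`.
    obtain rfl : D = n * e + (n - 2) := by
      rw [Nat.mul_add] at hD; omega
    exact (veronese_isHomogeneous hH).mul ((mem_homogeneousSubmodule _ _).1 (Subtype.prop _))
  | zero => exact ⟨0, fun j => by simp, fun i D _ => isHomogeneous_zero _ _ _⟩
  | add x y _ _ hx hy =>
    obtain ⟨f, hf, hf'⟩ := hx
    obtain ⟨g, hg, hg'⟩ := hy
    exact ⟨f + g, fun j => by simp [hf j, hg j, add_mul, Finset.sum_add_distrib],
      fun i D hD => (hf' i D hD).add (hg' i D hD)⟩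
  | smul c x _ hx =>
    obtain ⟨f, hf, hf'⟩ := hx
    refine ⟨c • f, fun j => by simp [hf j, Finset.smul_sum], fun i D hD => ?_⟩
    exact (homogeneousSubmodule (Fin 2) k D).smul_mem c (hf' i D hD)

/-! ### First-order deformations of the Veronese map. -/

/-- Evaluation of polynomials at the point `(v_j + ε ℓ_j)_j` over the dual numbers, where
`v_j = x₀ ^ j * x₁ ^ (n - j)`: a first order deformation of the Veronese map. -/
def deform (n : ℕ) (ℓ : ℕ → Rat₂ k) : MvPolynomial (Fin (n + 1)) k →ₐ[k] DualNumber (Rat₂ k) :=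
  aeval fun j => TrivSqZeroExt.inl (algebraMap _ (Rat₂ k) (veroneseMonomial k n j)) +
    TrivSqZeroExt.inr (ℓ j)

variable (ℓ : ℕ → Rat₂ k)

lemma deform_X (j : Fin (n + 1)) : deform n ℓ (X j) =
    TrivSqZeroExt.inl (algebraMap _ (Rat₂ k) (veroneseMonomial k n j)) +
    TrivSqZeroExt.inr (ℓ j) := by
  simp [deform]

lemma deform_C (c : k) : deform n ℓ (C c) =
    TrivSqZeroExt.inl (algebraMap (MvPolynomial (Fin 2) k) (Rat₂ k) (C c)) := by
  rw [← algebraMap_eq, AlgHom.commutes, TrivSqZeroExt.algebraMap_eq_inl',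
    ← algebraMap_eq, ← IsScalarTower.algebraMap_apply]

lemma fst_deform (F : MvPolynomial (Fin (n + 1)) k) :
    (deform n ℓ F).fst = algebraMap _ (Rat₂ k) (veronese k n F) := by
  induction F using MvPolynomial.induction_on with
  | C c => rw [deform_C, TrivSqZeroExt.fst_inl]; simp [veronese]
  | add p q hp hq => simp [hp, hq]
  | mul_X p j hp => simp [hp, deform_X, veronese]

lemma snd_deform (F : MvPolynomial (Fin (n + 1)) k) :
    (deform n ℓ F).snd = ∑ j, algebraMap _ (Rat₂ k) (veronese k n (pderiv j F)) * ℓ j := by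
  induction F using MvPolynomial.induction_on with
  | C c => rw [deform_C, TrivSqZeroExt.snd_inl]; simp
  | add p q hp hq => simp [hp, hq, add_mul, Finset.sum_add_distrib]
  | mul_X p i hp =>
    rw [map_mul, TrivSqZeroExt.snd_mul, hp, deform_X, fst_deform]
    simp only [Derivation.leibniz, smul_eq_mul, map_add, map_mul, add_mul, Finset.sum_add_distrib]
    congr 1
    · rw [Finset.sum_eq_single i]
      · simp
      · intro j _ hj
        simp [pderiv_X_of_ne hj.symm]
      · simp
    · simp only [TrivSqZeroExt.fst_add, TrivSqZeroExt.fst_inl, TrivSqZeroExt.fst_inr, add_zero,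
        MulOpposite.smul_eq_mul_unop, MulOpposite.unop_op, Finset.sum_mul, veronese, aeval_X]
      exact Finset.sum_congr rfl fun j _ => by ring

/-- The values of `ℓ` on the conormal vectors `β_i`. -/
def conormalCoeff (i : ℕ) : Rat₂ k :=
  algebraMap (MvPolynomial (Fin 2) k) (Rat₂ k) (X 0 ^ 2) * ℓ i -
    algebraMap (MvPolynomial (Fin 2) k) (Rat₂ k) (2 * X 0 * X 1) * ℓ (i + 1) +
    algebraMap (MvPolynomial (Fin 2) k) (Rat₂ k) (X 1 ^ 2) * ℓ (i + 2)

lemma sum_beta_mul (i : Fin (n - 1)) :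
    ∑ j : Fin (n + 1), algebraMap _ (Rat₂ k) (beta k n i j) * ℓ j = conormalCoeff ℓ i := by
  have hi := i.2
  have hδ (m : ℕ) (hm : m < n + 1) (c : Rat₂ k) :
      ∑ j : Fin (n + 1), c * (if (j : ℕ) = m then 1 else 0) * ℓ j = c * ℓ m := by
    rw [Finset.sum_eq_single ⟨m, hm⟩]
    · simp
    · intro j _ hj
      rw [if_neg fun h => hj (Fin.ext h)]
      simp
    · simp
  simp only [beta_eq, map_add, map_sub, map_mul _ _ (ite _ _ _), apply_ite (algebraMap _ (Rat₂ k)),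
    map_one, map_zero, add_mul, sub_mul, Finset.sum_add_distrib, Finset.sum_sub_distrib]
  rw [hδ _ (by omega), hδ _ (by omega), hδ _ (by omega), conormalCoeff]

lemma snd_deform_of_isConormalClass {F : MvPolynomial (Fin (n + 1)) k}
    {g : Fin (n - 1) → MvPolynomial (Fin 2) k} (hg : IsConormalClass F g) :
    (deform n ℓ F).snd = ∑ i, algebraMap _ (Rat₂ k) (g i) * conormalCoeff ℓ i := by
  rw [snd_deform]
  simp only [hg _, ← sum_beta_mul, map_sum, map_mul, Finset.sum_mul, Finset.mul_sum]
  rw [Finset.sum_comm]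
  simp only [mul_assoc]

/-- The value of `F` has no constant part, so only the constant part of `H` contributes. This is the
linearity of the conormal functional over the coordinate ring. -/
lemma snd_deform_mul {F H : MvPolynomial (Fin (n + 1)) k} (hF : veronese k n F = 0) :
    (deform n ℓ (H * F)).snd = algebraMap _ (Rat₂ k) (veronese k n H) * (deform n ℓ F).snd := by
  rw [map_mul, TrivSqZeroExt.snd_mul, fst_deform, fst_deform, hF]
  simp

/-- The equations form a second-order recursion with leading coefficient `x₁²`, which is invertible
in the function field. The solution is not unique; the first two values are taken to be 0. -/
lemma exists_conormalCoeff_eq (Λ : ℕ → Rat₂ k) : ∃ ℓ : ℕ → Rat₂ k, ∀ i, conormalCoeff ℓ i = Λ i := by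
  have h1 : algebraMap (MvPolynomial (Fin 2) k) (Rat₂ k) (X 1 ^ 2) ≠ 0 :=
    (map_ne_zero_iff _ (IsFractionRing.injective _ _)).2 (pow_ne_zero _ (X_ne_zero _))
  let step : ℕ → Rat₂ k × Rat₂ k → Rat₂ k × Rat₂ k := fun i p =>
    (p.2, (Λ i - algebraMap (MvPolynomial (Fin 2) k) (Rat₂ k) (X 0 ^ 2) * p.1 +
      algebraMap (MvPolynomial (Fin 2) k) (Rat₂ k) (2 * X 0 * X 1) * p.2) /
      algebraMap (MvPolynomial (Fin 2) k) (Rat₂ k) (X 1 ^ 2))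
  let s : ℕ → Rat₂ k × Rat₂ k := fun i => Nat.rec 0 step i
  refine ⟨fun i => (s i).1, fun i => ?_⟩
  have e1 : (s (i + 1)).1 = (s i).2 := rfl
  have e2 : (s (i + 2)).1 = (Λ i - algebraMap (MvPolynomial (Fin 2) k) (Rat₂ k) (X 0 ^ 2) * (s i).1 +
      algebraMap (MvPolynomial (Fin 2) k) (Rat₂ k) (2 * X 0 * X 1) * (s i).2) /
      algebraMap (MvPolynomial (Fin 2) k) (Rat₂ k) (X 1 ^ 2) := rfl
  rw [conormalCoeff, e1, e2, mul_div_cancel₀ _ h1]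
  ring

lemma algebraMap_veroneseMonomial_ne_zero (a : Fin (n + 1)) :
    algebraMap _ (Rat₂ k) (veroneseMonomial k n a) ≠ 0 :=
  (map_ne_zero_iff _ (IsFractionRing.injective _ _)).2 (veroneseMonomial_ne_zero k n a)

lemma veronese_X (a : Fin (n + 1)) : veronese k n (X a) = veroneseMonomial k n a := by
  simp [veronese]

/-- The ideal of the curve is prime and contains no coordinate, so clearing denominators loses
nothing. -/
lemma dehomogenize_mem_rationalNormalCurve_iff {d : ℕ} (F : grading k n d) (a : Fin (n + 1)) :
    dehomogenize F a ∈ chartIdeal (rationalNormalCurve k n) a ↔ veronese k n F.1 = 0 := by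
  rw [rationalNormalCurve, dehomogenize_mem_chartIdeal_iff]
  simp only [RingHom.mem_ker, map_mul, map_pow, veronese_X]
  constructor
  · rintro ⟨m, hm⟩
    exact (mul_eq_zero.1 hm).resolve_left (pow_ne_zero _ (veroneseMonomial_ne_zero k n a))
  · intro h
    exact ⟨0, by simp [h]⟩

lemma restrict_dehomogenize_mul {d : ℕ} (F : grading k n d) (a : Fin (n + 1)) :
    restrict k n a (dehomogenize F a) * algebraMap _ (Rat₂ k) (veroneseMonomial k n a ^ d) =
      algebraMap _ (Rat₂ k) (veronese k n F.1) := by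
  have h := IsLocalization.mk'_spec (Localization.Away (X a : MvPolynomial (Fin (n + 1)) k)) F.1
    (⟨X a ^ d, d, rfl⟩ : Submonoid.powers (X a : MvPolynomial (Fin (n + 1)) k))
  rw [← algebraMap_dehomogenize] at h
  rw [restrict, RingHom.comp_apply]
  have hX : algebraMap _ (Rat₂ k) (veroneseMonomial k n a ^ d) =
      ((algebraMap (MvPolynomial (Fin 2) k) (Rat₂ k)).comp (veronese k n).toRingHom) (X a ^ d) := by
    simp [veronese_X]
  have hF : algebraMap _ (Rat₂ k) (veronese k n F.1) =
      ((algebraMap (MvPolynomial (Fin 2) k) (Rat₂ k)).comp (veronese k n).toRingHom) F.1 := rfl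
  have hu : IsUnit (((algebraMap (MvPolynomial (Fin 2) k) (Rat₂ k)).comp
      (veronese k n).toRingHom) (X a)) := by
    rw [isUnit_iff_ne_zero]
    simpa [veronese_X] using algebraMap_veroneseMonomial_ne_zero (k := k) a
  rw [hX, hF]
  rw [← IsLocalization.Away.lift_eq (S := Localization.Away (X a : MvPolynomial (Fin (n + 1)) k))
      (X a) hu (X a ^ d), ← map_mul, h, IsLocalization.Away.lift_eq]

lemma restrict_eq_zero_of_mem {a : Fin (n + 1)} {z : Chart k n a}
    (hz : z ∈ chartIdeal (rationalNormalCurve k n) a) : restrict k n a z = 0 := by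
  obtain ⟨d, F, rfl⟩ := dehomogenize_surjective a z
  have h := restrict_dehomogenize_mul F a
  rw [(dehomogenize_mem_rationalNormalCurve_iff F a).1 hz, map_zero, map_pow] at h
  exact (mul_eq_zero.1 h).resolve_right (pow_ne_zero _ (algebraMap_veroneseMonomial_ne_zero a))

lemma isUnit_deform_X (a : Fin (n + 1)) : IsUnit (deform n ℓ (X a)) := by
  rw [TrivSqZeroExt.isUnit_iff_isUnit_fst, fst_deform, veronese_X, isUnit_iff_ne_zero]
  exact algebraMap_veroneseMonomial_ne_zero a

/-- The deformation `deform` on the chart `D₊(u_a)`. -/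
def chartDeform (a : Fin (n + 1)) : Chart k n a →+* DualNumber (Rat₂ k) :=
  (IsLocalization.Away.lift (S := Localization.Away (X a : MvPolynomial (Fin (n + 1)) k))
    (X a : MvPolynomial (Fin (n + 1)) k) (g := (deform n ℓ).toRingHom)
    (isUnit_deform_X ℓ a)).comp
  (algebraMap (Chart k n a) (Localization.Away (X a : MvPolynomial (Fin (n + 1)) k)))

lemma chartDeform_dehomogenize_mul {d : ℕ} (F : grading k n d) (a : Fin (n + 1)) :
    chartDeform ℓ a (dehomogenize F a) * deform n ℓ (X a) ^ d = deform n ℓ F.1 := by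
  have h := IsLocalization.mk'_spec (Localization.Away (X a : MvPolynomial (Fin (n + 1)) k)) F.1
    (⟨X a ^ d, d, rfl⟩ : Submonoid.powers (X a : MvPolynomial (Fin (n + 1)) k))
  rw [← algebraMap_dehomogenize] at h
  rw [chartDeform, RingHom.comp_apply, ← map_pow]
  change _ * (deform n ℓ).toRingHom (X a ^ d) = (deform n ℓ).toRingHom F.1
  rw [← IsLocalization.Away.lift_eq (S := Localization.Away (X a : MvPolynomial (Fin (n + 1)) k))
      (X a) (isUnit_deform_X ℓ a) (X a ^ d), ← map_mul, h, IsLocalization.Away.lift_eq]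

lemma fst_chartDeform (a : Fin (n + 1)) (z : Chart k n a) :
    (chartDeform ℓ a z).fst = restrict k n a z := by
  obtain ⟨d, F, rfl⟩ := dehomogenize_surjective a z
  have h1 := congr(TrivSqZeroExt.fst $(chartDeform_dehomogenize_mul ℓ F a))
  rw [TrivSqZeroExt.fst_mul, TrivSqZeroExt.fst_pow, fst_deform, fst_deform, veronese_X,
    ← restrict_dehomogenize_mul F a, map_pow] at h1
  exact mul_right_cancel₀ (pow_ne_zero _ (algebraMap_veroneseMonomial_ne_zero a)) h1

lemma snd_chartDeform_mul {d : ℕ} (F : grading k n d) (hF : veronese k n F.1 = 0)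
    (a : Fin (n + 1)) :
    algebraMap _ (Rat₂ k) (veroneseMonomial k n a ^ d) * (chartDeform ℓ a (dehomogenize F a)).snd =
      (deform n ℓ F.1).snd := by
  have h1 := congr(TrivSqZeroExt.snd $(chartDeform_dehomogenize_mul ℓ F a))
  rw [TrivSqZeroExt.snd_mul, TrivSqZeroExt.fst_pow, fst_deform, veronese_X, fst_chartDeform,
    restrict_eq_zero_of_mem ((dehomogenize_mem_rationalNormalCurve_iff F a).2 hF), zero_smul,
    zero_add, MulOpposite.smul_eq_mul_unop, MulOpposite.unop_op] at h1
  rw [← h1, map_pow, mul_comm]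

/-- The morphism from the ideal of the rational normal curve on `D₊(u_a)` given by `deform`. -/
def chartFunctional (a : Fin (n + 1)) : chartIdeal (rationalNormalCurve k n) a →+ Rat₂ k where
  toFun g := (chartDeform ℓ a g.1).snd
  map_zero' := by simp
  map_add' x y := by simp

lemma chartFunctional_smul (a : Fin (n + 1)) (f : Chart k n a)
    (g : chartIdeal (rationalNormalCurve k n) a) :
    chartFunctional ℓ a (f • g) = restrict k n a f * chartFunctional ℓ a g := by
  simp only [chartFunctional, AddMonoidHom.coe_mk, ZeroHom.coe_mk, Submodule.coe_smul, smul_eq_mul,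
    map_mul, TrivSqZeroExt.snd_mul, fst_chartDeform, restrict_eq_zero_of_mem g.2]
  simp

/-! ### The ribbon of a linear form, and quadrics containing it. -/

section Ribbon

variable {ℓ}

/-- `ℓ` represents the linear form `lam` on `H⁰(ℙ¹, 𝒪(n - 2))`. -/
def Represents (ℓ : ℕ → Rat₂ k) (lam : Module.Dual k (Forms k (n - 2))) : Prop :=
  ∀ i : Fin (n - 1), conormalCoeff ℓ i =
    algebraMap (MvPolynomial (Fin 2) k) (Rat₂ k) (C (lam (monomialForm k n i)))

lemma exists_represents (lam : Module.Dual k (Forms k (n - 2))) :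
    ∃ ℓ : ℕ → Rat₂ k, Represents ℓ lam := by
  obtain ⟨ℓ, h⟩ := exists_conormalCoeff_eq (k := k) fun i =>
    if hi : i < n - 1 then
      algebraMap (MvPolynomial (Fin 2) k) (Rat₂ k) (C (lam (monomialForm k n ⟨i, hi⟩))) else 0
  exact ⟨ℓ, fun i => by rw [h, dif_pos i.2]⟩

variable {lam : Module.Dual k (Forms k (n - 2))}

lemma Represents.snd_deform (h : Represents ℓ lam) {F : MvPolynomial (Fin (n + 1)) k}
    {g : Fin (n - 1) → MvPolynomial (Fin 2) k} (hg : IsConormalClass F g) :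
    (deform n ℓ F).snd =
      algebraMap _ (Rat₂ k) (∑ i, lam (monomialForm k n i) • g i) := by
  rw [snd_deform_of_isConormalClass ℓ hg, map_sum]
  refine Finset.sum_congr rfl fun i _ => ?_
  rw [h i, smul_eq_C_mul, map_mul, mul_comm]

/-- The constant part tests vanishing on the curve and the ε-part is `λ` of any conormal class.
Describing membership through a ring homomorphism that sends each `u_a` to a unit makes passage to
the charts immediate. -/
lemma Represents.mem_ribbonIdeal_iff (h : Represents ℓ lam) (hn : 2 ≤ n) {d : ℕ}
    {F : MvPolynomial (Fin (n + 1)) k} (hF : F ∈ grading k n d) :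
    F ∈ ribbonIdeal lam ↔ deform n ℓ F = 0 := by
  constructor
  · rintro ⟨h0, g, hg, hg'⟩
    ext
    · simp [fst_deform, h0]
    · rw [h.snd_deform hg, hg']
      simp
  · intro h0
    have hv : veronese k n F = 0 := by
      have := congr(TrivSqZeroExt.fst $h0)
      rw [fst_deform, TrivSqZeroExt.fst_zero] at this
      exact (map_eq_zero_iff _ (IsFractionRing.injective _ _)).1 this
    obtain ⟨g, hg, -⟩ := exists_isConormalClass hn hF hv
    refine ⟨hv, g, hg, ?_⟩
    have := congr(TrivSqZeroExt.snd $h0)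
    rw [h.snd_deform hg, TrivSqZeroExt.snd_zero] at this
    exact (map_eq_zero_iff _ (IsFractionRing.injective _ _)).1 this

lemma Represents.dehomogenize_mem_ribbon_iff (h : Represents ℓ lam) (hn : 2 ≤ n) {d : ℕ}
    (F : grading k n d) (a : Fin (n + 1)) :
    dehomogenize F a ∈ chartIdeal (ribbon lam) a ↔ deform n ℓ F.1 = 0 := by
  rw [ribbon, dehomogenize_mem_chartIdeal_iff]
  have hmem (m : ℕ) : X a ^ m * F.1 ∈ grading k n (m • 1 + d) :=
    SetLike.mul_mem_graded (SetLike.pow_mem_graded m (X_mem_grading k n a)) F.2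
  constructor
  · rintro ⟨m, hm⟩
    rw [h.mem_ribbonIdeal_iff hn (hmem m), map_mul, map_pow] at hm
    exact (((isUnit_deform_X ℓ a).pow m).mul_right_eq_zero).1 hm
  · intro h0
    refine ⟨0, ?_⟩
    rw [h.mem_ribbonIdeal_iff hn (hmem 0), map_mul, h0, mul_zero]

lemma contract_eq_sum_coord (hn : 2 ≤ n) (lam : Module.Dual k (Forms k (n - 2)))
    (q : Forms k (n - 2) ⊗[k] Forms k (n - 2)) :
    contract lam q = ∑ i, lam (monomialForm k n i) •
      contract ((monomialBasis k n hn).coord i) q := by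
  induction q with
  | zero => simp
  | tmul x y =>
    simp only [contract_tmul, smul_smul, ← Finset.sum_smul]
    congr 1
    conv_lhs => rw [← (monomialBasis k n hn).sum_repr x]
    simp [mul_comm]
  | add x y hx hy => simp [hx, hy, Finset.sum_add_distrib]

/-- The computation behind (i): expanding `λ` in the dual monomial basis turns the conormal
coordinates of the quadric into the contraction of `q`. -/
lemma Represents.snd_deform_quadric (h : Represents ℓ lam) (hn : 2 ≤ n)
    {q : Forms k (n - 2) ⊗[k] Forms k (n - 2)}
    (hq : q ∈ symmTensors (k := k) (Forms k (n - 2))) :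
    (deform n ℓ (quadric n q).1).snd = algebraMap _ (Rat₂ k) (contract lam q).1 := by
  rw [h.snd_deform (isConormalClass_quadric hn hq), contract_eq_sum_coord hn lam q]
  simp

lemma Represents.deform_quadric_eq_zero_iff (h : Represents ℓ lam) (hn : 2 ≤ n)
    {q : Forms k (n - 2) ⊗[k] Forms k (n - 2)}
    (hq : q ∈ symmTensors (k := k) (Forms k (n - 2))) :
    deform n ℓ (quadric n q).1 = 0 ↔ contract lam q = 0 := by
  rw [TrivSqZeroExt.ext_iff, fst_deform, veronese_quadric hn, h.snd_deform_quadric hn hq]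
  simp

lemma vanishesOn_ribbon_iff (hn : 2 ≤ n) (lam : Module.Dual k (Forms k (n - 2)))
    {q : Forms k (n - 2) ⊗[k] Forms k (n - 2)}
    (hq : q ∈ symmTensors (k := k) (Forms k (n - 2))) :
    VanishesOn (quadric n q) (ribbon lam) ↔ contract lam q = 0 := by
  obtain ⟨ℓ, h⟩ := exists_represents lam
  rw [← h.deform_quadric_eq_zero_iff hn hq, VanishesOn]
  simp only [h.dehomogenize_mem_ribbon_iff hn, forall_const]

lemma ribbon_le_rationalNormalCurve (lam : Module.Dual k (Forms k (n - 2))) :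
    ribbon lam ≤ rationalNormalCurve k n :=
  idealSheaf_mono fun _ hF => hF.1

end Ribbon

lemma bijOn_quadric (hn : 2 ≤ n) :
    Set.BijOn (quadric (k := k) n) (symmTensors (k := k) (Forms k (n - 2)))
      {F | VanishesOn F (rationalNormalCurve k n)} := by
  refine ⟨fun q _ a => ?_, fun q hq q' hq' h => ?_, fun F hF => ?_⟩
  · exact (dehomogenize_mem_rationalNormalCurve_iff _ a).2 (veronese_quadric hn q)
  · rw [eq_sum_tensorMatrix (monomialBasis k n hn) q, eq_sum_tensorMatrix (monomialBasis k n hn) q']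
    refine Finset.sum_congr rfl fun i _ => Finset.sum_congr rfl fun j _ => ?_
    -- Deforming along the `i`-th coordinate functional recovers the `i`-th row of the matrix of `q`
    -- from its quadric.
    obtain ⟨ℓ, hℓ⟩ := exists_represents ((monomialBasis k n hn).coord i)
    have hc := hℓ.snd_deform_quadric hn hq
    rw [h, hℓ.snd_deform_quadric hn hq'] at hc
    rw [← repr_contract_coord, ← repr_contract_coord,
      Subtype.ext (IsFractionRing.injective _ _ hc)]
  · exact exists_quadric_eq_of_veronese_eq_zero hn F
      ((dehomogenize_mem_rationalNormalCurve_iff F 0).1 (hF 0))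

/-! ### Surjectivity: the ribbon of a nonzero linear form is canonical. -/

section Ribbon

variable {ℓ} {lam : Module.Dual k (Forms k (n - 2))}

lemma Represents.exists_snd_deform_eq (h : Represents ℓ lam) (hn : 2 ≤ n) (hlam : lam ≠ 0)
    (M : ℕ) {s : MvPolynomial (Fin 2) k} (hs : s.IsHomogeneous (n * M + (n - 2))) :
    ∃ F ∈ grading k n (M + 2), veronese k n F = 0 ∧
      (deform n ℓ F).snd = algebraMap _ (Rat₂ k) s := by
  have hs' := form_mem_span hs
  clear hs
  induction hs' using Submodule.span_induction with
  | mem s hs =>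
    obtain ⟨p, q, hpq, rfl⟩ := hs
    -- The monomial splits into one of degree `nM`, with as much `x₀` as fits, and one of degree `n
    -- - 2`. The first is the restriction of a normal monomial, and the second is the contraction of
    -- a symmetric tensor because `λ ≠ 0`.
    have hw : min p (n * M) ≤ n * M := min_le_right _ _
    have hb : (X 0 ^ (p - min p (n * M)) * X 1 ^ (q - (n * M - min p (n * M))) :
        MvPolynomial (Fin 2) k) ∈ homogeneousSubmodule (Fin 2) k (n - 2) := by
      rw [mem_homogeneousSubmodule]
      convert isHomogeneous_pow_mul_pow (k := k) _ _ using 1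
      omega
    obtain ⟨t, ht, ht'⟩ := exists_contract_eq lam hlam ⟨_, hb⟩
    refine ⟨normalMonomial k n M (min p (n * M)) * (quadric n t).1,
      SetLike.mul_mem_graded (normalMonomial_mem _ _) (quadric n t).2, ?_, ?_⟩
    · rw [map_mul, veronese_quadric hn, mul_zero]
    · rw [snd_deform_mul ℓ (veronese_quadric hn t), h.snd_deform_quadric hn ht, ht', ← map_mul,
        veronese_normalMonomial _ _ hw, mul_mul_mul_comm, ← pow_add, ← pow_add]
      congr 3 <;> omega
  | zero => exact ⟨0, zero_mem _, by simp, by simp⟩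
  | add x y _ _ hx hy =>
    obtain ⟨F, h1, h2, h3⟩ := hx
    obtain ⟨G, h4, h5, h6⟩ := hy
    exact ⟨F + G, add_mem h1 h4, by simp [h2, h5], by simp [h3, h6]⟩
  | smul c x _ hx =>
    obtain ⟨F, h1, h2, h3⟩ := hx
    refine ⟨C c * F, ?_, by simp [h2], ?_⟩
    · rw [← smul_eq_C_mul]
      exact Submodule.smul_mem _ _ h1
    · rw [snd_deform_mul ℓ h2, h3, smul_eq_C_mul, map_mul]
      simp [veronese]

lemma Represents.range_chartFunctional (h : Represents ℓ lam) (hn : 2 ≤ n) (hlam : lam ≠ 0)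
    (a : Fin (n + 1)) :
    Set.range (chartFunctional ℓ a) = twistSections k n a (-(n + 2 : ℤ)) := by
  have hva := algebraMap_veroneseMonomial_ne_zero (k := k) a
  ext z
  constructor
  · rintro ⟨⟨g, hg⟩, rfl⟩
    obtain ⟨d, F, rfl⟩ := dehomogenize_surjective a g
    have hF := (dehomogenize_mem_rationalNormalCurve_iff F a).1 hg
    -- The factor `u_a²` raises the degree enough that `n(d + 2) - n - 2` is nonnegative, since `2n
    -- ≥ n + 2`.
    have hF2 : X a ^ 2 * F.1 ∈ grading k n (2 • 1 + d) :=
      SetLike.mul_mem_graded (SetLike.pow_mem_graded 2 (X_mem_grading k n a)) F.2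
    obtain ⟨c, hc, hc'⟩ := exists_isConormalClass hn hF2 (by rw [map_mul, hF, mul_zero])
    obtain ⟨D, hD⟩ : ∃ D, D + n + 2 = n * (2 • 1 + d) := by
      refine ⟨n * (2 • 1 + d) - n - 2, ?_⟩
      have : n * (2 • 1 + d) = n * d + 2 * n := by simp; ring
      omega
    refine ⟨d + 2, D, ⟨∑ i, lam (monomialForm k n i) • c i, ?_⟩, ?_, ?_⟩
    · exact Submodule.sum_mem _ fun i _ => Submodule.smul_mem _ _
        ((mem_homogeneousSubmodule _ _).2 (hc' i D hD))
    · zify at hD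
      push_cast
      simp at hD
      linarith
    · have h1 := snd_chartDeform_mul ℓ F hF a
      have h2 := snd_deform_mul ℓ (H := X a ^ 2) hF
      rw [h.snd_deform hc, ← h1, map_pow, veronese_X] at h2
      rw [h2]
      simp only [chartFunctional, AddMonoidHom.coe_mk, ZeroHom.coe_mk, map_pow]
      ring
  · rintro ⟨N, e, s, he, hs⟩
    obtain ⟨M, rfl⟩ : ∃ M, N = M + 2 := by
      refine ⟨N - 2, ?_⟩
      -- For `N ≤ 1` the numerator of a section of `𝒪(-n-2)` would have negative degree `Nn - n -
      -- 2`.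
      have : 2 ≤ N := by
        by_contra! hN
        have h1 : (N : ℤ) * n ≤ 1 * n :=
          mul_le_mul_of_nonneg_right (by exact_mod_cast Nat.lt_succ_iff.1 hN) (by positivity)
        have h2 : (0 : ℤ) ≤ e := by positivity
        linarith
      omega
    have he' : e = n * M + (n - 2) := by
      zify [hn]
      push_cast at he
      linarith
    obtain ⟨F, hF, hF0, hFs⟩ := h.exists_snd_deform_eq hn hlam M
      (s := s.1) (by rw [← he']; exact (mem_homogeneousSubmodule _ _).1 s.2)
    refine ⟨⟨dehomogenize (⟨F, hF⟩ : grading k n (M + 2)) a,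
      (dehomogenize_mem_rationalNormalCurve_iff _ a).2 hF0⟩, ?_⟩
    have h1 := snd_chartDeform_mul ℓ (⟨F, hF⟩ : grading k n (M + 2)) hF0 a
    rw [hFs, ← hs, mul_comm z] at h1
    rw [map_pow] at h1
    exact mul_left_cancel₀ (pow_ne_zero _ hva) h1

lemma isCanonicalRibbon_ribbon (hn : 2 ≤ n) (hlam : lam ≠ 0) :
    IsCanonicalRibbon (ribbon lam) := by
  obtain ⟨ℓ, h⟩ := exists_represents lam
  refine ⟨ribbon_le_rationalNormalCurve lam, chartFunctional ℓ, chartFunctional_smul ℓ, ?_,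
    h.range_chartFunctional hn hlam, ?_⟩
  · intro a b d F ha hb
    have hF := (dehomogenize_mem_rationalNormalCurve_iff F a).1 ha
    exact (snd_chartDeform_mul ℓ F hF a).trans (snd_chartDeform_mul ℓ F hF b).symm
  · rintro a ⟨g, hg⟩
    obtain ⟨d, F, rfl⟩ := dehomogenize_surjective a g
    have hF := (dehomogenize_mem_rationalNormalCurve_iff F a).1 hg
    rw [h.dehomogenize_mem_ribbon_iff hn, TrivSqZeroExt.ext_iff, fst_deform, hF,
      ← snd_chartDeform_mul ℓ F hF a]
    simp only [chartFunctional, AddMonoidHom.coe_mk, ZeroHom.coe_mk, map_zero,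
      TrivSqZeroExt.fst_zero, TrivSqZeroExt.snd_zero, true_and, mul_eq_zero, map_pow,
      pow_ne_zero _ (algebraMap_veroneseMonomial_ne_zero (k := k) a), false_or]

end Ribbon

/-! ### Linear maps on the ideal of the curve. -/

variable (k) in
/-- The forms of degree `d` that vanish on the rational normal curve. -/
def vanishingForms (n d : ℕ) : Submodule k (MvPolynomial (Fin (n + 1)) k) :=
  grading k n d ⊓ LinearMap.ker (veronese k n).toLinearMap

lemma mem_vanishingForms {d : ℕ} {F : MvPolynomial (Fin (n + 1)) k} :
    F ∈ vanishingForms k n d ↔ F ∈ grading k n d ∧ veronese k n F = 0 := Iff.rfl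

lemma minor_mem_vanishingForms {i j : ℕ} (hi : i < n) (hj : j < n) :
    minor k n i j ∈ vanishingForms k n 2 :=
  ⟨minor_mem i j, veronese_minor hi hj⟩

lemma mul_mem_vanishingForms {d e : ℕ} {H F : MvPolynomial (Fin (n + 1)) k}
    (hH : H ∈ grading k n e) (hF : F ∈ vanishingForms k n d) :
    H * F ∈ vanishingForms k n (e + d) :=
  ⟨SetLike.mul_mem_graded hH hF.1, by
    change veronese k n (H * F) = 0
    rw [map_mul, (mem_vanishingForms.1 hF).2, mul_zero]⟩

lemma minorSpan_le_vanishingForms (d : ℕ) : minorSpan k n d ≤ vanishingForms k n d := by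
  refine Submodule.span_le.2 ?_
  rintro _ ⟨e, i, j, H, hH, rfl, hi, hj, rfl⟩
  exact mul_mem_vanishingForms hH (minor_mem_vanishingForms hi hj)

/-- A family of additive maps on the forms vanishing on the rational normal curve that is linear
over the coordinate ring of `ℙⁿ`. -/
def IsModuleMap (T : ∀ d, vanishingForms k n d →+ Rat₂ k) : Prop :=
  ∀ (e d d' : ℕ) (H : MvPolynomial (Fin (n + 1)) k) (_ : H ∈ grading k n e)
    (F : vanishingForms k n d) (_ : e + d = d') (hHF : H * F.1 ∈ vanishingForms k n d'),
    T d' ⟨H * F.1, hHF⟩ = algebraMap _ (Rat₂ k) (veronese k n H) * T d F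

lemma algebraMap_veronese_coord_ne_zero {i : ℕ} (hi : i ≤ n) :
    algebraMap _ (Rat₂ k) (veronese k n (coord k n i)) ≠ 0 := by
  rw [veronese_coord hi]
  exact algebraMap_veroneseMonomial_ne_zero (k := k) ⟨i, Nat.lt_succ_of_le hi⟩

/-- This is the syzygy `u_0 m_ij = u_i m_0j - u_j m_0i`, where `m_ij` are the minors. -/
lemma IsModuleMap.map_minor {T : ∀ d, vanishingForms k n d →+ Rat₂ k} (hT : IsModuleMap T)
    (i j : Fin n) :
    algebraMap _ (Rat₂ k) (veronese k n (coord k n 0)) *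
        T 2 ⟨minor k n i j, minor_mem_vanishingForms i.2 j.2⟩ =
      algebraMap _ (Rat₂ k) (veronese k n (coord k n i)) *
        T 2 ⟨minor k n 0 j, minor_mem_vanishingForms i.pos j.2⟩ -
      algebraMap _ (Rat₂ k) (veronese k n (coord k n j)) *
        T 2 ⟨minor k n 0 i, minor_mem_vanishingForms i.pos i.2⟩ := by
  have h (l : ℕ) (F : vanishingForms k n 2) := hT 1 2 3 (coord k n l) (coord_mem l) F rfl
    (mul_mem_vanishingForms (coord_mem l) F.2)
  rw [← h, ← h, ← h, ← map_sub]
  congr 1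
  apply Subtype.ext
  simp only [minor, AddSubgroupClass.coe_sub]
  ring

/-- A module map is determined by its values on the minors that involve the first column. -/
lemma IsModuleMap.ext {T T' : ∀ d, vanishingForms k n d →+ Rat₂ k} (hT : IsModuleMap T)
    (hT' : IsModuleMap T')
    (h : ∀ (j : ℕ) (h0 : 0 < n) (hj : j < n),
      T 2 ⟨minor k n 0 j, minor_mem_vanishingForms h0 hj⟩ =
        T' 2 ⟨minor k n 0 j, minor_mem_vanishingForms h0 hj⟩)
    (d : ℕ) (F : vanishingForms k n d) : T d F = T' d F := by
  obtain ⟨F, hF⟩ := F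
  have hF' := mem_minorSpan_of_veronese_eq_zero hF.1 hF.2
  induction hF' using Submodule.span_induction with
  | mem F hF' =>
    obtain ⟨e, i, j, H, hH, rfl, hi, hj, rfl⟩ := hF'
    rw [hT e 2 _ H hH ⟨_, minor_mem_vanishingForms hi hj⟩ rfl hF,
      hT' e 2 _ H hH ⟨_, minor_mem_vanishingForms hi hj⟩ rfl hF]
    congr 1
    have h1 := hT.map_minor ⟨i, hi⟩ ⟨j, hj⟩
    have h2 := hT'.map_minor ⟨i, hi⟩ ⟨j, hj⟩
    rw [h j (by omega) hj, h i (by omega) hi, ← h2] at h1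
    exact mul_left_cancel₀ (algebraMap_veronese_coord_ne_zero (Nat.zero_le n)) h1
  | zero => exact ((T d).map_zero).trans ((T' d).map_zero).symm
  | add x y hx hy ihx ihy =>
    have hx' := minorSpan_le_vanishingForms d hx
    have hy' := minorSpan_le_vanishingForms d hy
    have h1 := (T d).map_add ⟨x, hx'⟩ ⟨y, hy'⟩
    have h2 := (T' d).map_add ⟨x, hx'⟩ ⟨y, hy'⟩
    rw [ihx hx', ihy hy', ← h2] at h1
    exact h1
  | smul c x hx ihx =>
    have hx' := minorSpan_le_vanishingForms d hx
    have hF2 : C c * x ∈ vanishingForms k n d := by rwa [← smul_eq_C_mul]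
    have h1 := hT 0 d d (C c) (isHomogeneous_C _ _) ⟨x, hx'⟩ (zero_add d) hF2
    have h2 := hT' 0 d d (C c) (isHomogeneous_C _ _) ⟨x, hx'⟩ (zero_add d) hF2
    rw [ihx hx', ← h2] at h1
    convert h1 using 3 <;> exact smul_eq_C_mul _ _

/-- The module map given by a deformation of the Veronese map. -/
def deformMap (n : ℕ) (ℓ : ℕ → Rat₂ k) (d : ℕ) : vanishingForms k n d →+ Rat₂ k where
  toFun F := (deform n ℓ F.1).snd
  map_zero' := by simp
  map_add' x y := by simp

lemma isModuleMap_deformMap (ℓ : ℕ → Rat₂ k) : IsModuleMap (deformMap n ℓ) :=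
  fun _ _ _ _ _ F _ _ => snd_deform_mul ℓ F.2.2

variable (k) in
/-- The coordinates of `ℙ¹` as rational functions. -/
abbrev ratVar (i : Fin 2) : Rat₂ k := algebraMap (MvPolynomial (Fin 2) k) (Rat₂ k) (X i)

lemma ratVar_ne_zero (i : Fin 2) : ratVar k i ≠ 0 :=
  (map_ne_zero_iff _ (IsFractionRing.injective _ _)).2 (X_ne_zero _)

lemma snd_deform_minor (ℓ : ℕ → Rat₂ k) {i j : ℕ} (hi : i < n) (hj : j < n) :
    (deform n ℓ (minor k n i j)).snd =
      ratVar k 0 ^ i * ratVar k 1 ^ (n - i) * ℓ (j + 1) +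
      ratVar k 0 ^ (j + 1) * ratVar k 1 ^ (n - (j + 1)) * ℓ i -
      ratVar k 0 ^ (i + 1) * ratVar k 1 ^ (n - (i + 1)) * ℓ j -
      ratVar k 0 ^ j * ratVar k 1 ^ (n - j) * ℓ (i + 1) := by
  have h (m : ℕ) (hm : m ≤ n) : (deform n ℓ (coord k n m)).snd = ℓ m := by
    have := coord_val (k := k) (n := n) ⟨m, Nat.lt_succ_of_le hm⟩
    rw [show coord k n m = X ⟨m, Nat.lt_succ_of_le hm⟩ from this, deform_X]
    simp
  rw [minor, map_sub, map_mul, map_mul, TrivSqZeroExt.snd_sub, TrivSqZeroExt.snd_mul,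
    TrivSqZeroExt.snd_mul, h i hi.le, h j hj.le, h _ hi, h _ hj, fst_deform, fst_deform,
    fst_deform, fst_deform, veronese_coord hi.le, veronese_coord hj.le,
    veronese_coord (show i + 1 ≤ n from hi), veronese_coord (show j + 1 ≤ n from hj)]
  simp only [smul_eq_mul, MulOpposite.smul_eq_mul_unop, MulOpposite.unop_op, map_mul, map_pow]
  ring

/-- Every module map comes from a deformation of the Veronese map. -/
lemma IsModuleMap.exists_eq_deformMap {T : ∀ d, vanishingForms k n d →+ Rat₂ k}
    (hT : IsModuleMap T) : ∃ ℓ : ℕ → Rat₂ k, ∀ d F, T d F = deformMap n ℓ d F := by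
  rcases Nat.eq_zero_or_pos n with rfl | h0
  · exact ⟨0, hT.ext (isModuleMap_deformMap _) fun _ h => absurd h (lt_irrefl 0)⟩
  have hx1 := ratVar_ne_zero (k := k) 1
  set x₀ := ratVar k 0
  set x₁ := ratVar k 1
  let ν : ℕ → Rat₂ k := fun j =>
    if hj : j < n then T 2 ⟨minor k n 0 j, minor_mem_vanishingForms h0 hj⟩ else 0
  -- Normalising `ℓ 0 = 0` forces `ℓ 1 = 0`, because the minor `(0, 0)` is zero. The ε-part of the
  -- minor `(0, j)` is then `x₁^n ℓ (j+1) - x₀ x₁^(n-1) ℓ j`, and the recursion solves for `ℓ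
  -- (j+1)`.
  let ℓ : ℕ → Rat₂ k := fun j => Nat.rec 0 (fun i y => x₀ / x₁ * y + ν i / x₁ ^ n) j
  have hℓ0 : ℓ 0 = 0 := rfl
  have hℓ (j : ℕ) : ℓ (j + 1) = x₀ / x₁ * ℓ j + ν j / x₁ ^ n := rfl
  have hν0 : ν 0 = 0 := by
    have : (⟨minor k n 0 0, minor_mem_vanishingForms h0 h0⟩ : vanishingForms k n 2) = 0 :=
      Subtype.ext (by simp [minor, mul_comm])
    simp only [ν, dif_pos h0, this, map_zero]
  have hℓ1 : ℓ 1 = 0 := by rw [← zero_add 1, hℓ, hℓ0, hν0]; simp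
  refine ⟨ℓ, hT.ext (isModuleMap_deformMap _) fun j _ hj => ?_⟩
  have h1 : ν j = T 2 ⟨minor k n 0 j, minor_mem_vanishingForms h0 hj⟩ := dif_pos hj
  have h2 : x₁ ^ n = x₁ * x₁ ^ (n - 1) := by
    rw [← pow_succ', Nat.sub_add_cancel h0]
  rw [← h1]
  change _ = (deform n ℓ (minor k n 0 j)).snd
  rw [snd_deform_minor ℓ h0 hj, hℓ0, zero_add, hℓ1, hℓ]
  rw [Nat.sub_zero, pow_zero, pow_one, mul_zero, mul_zero, mul_add,
    one_mul, mul_div_cancel₀ _ (pow_ne_zero n hx1), h2]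
  field_simp
  ring

lemma dehomogenize_add {d : ℕ} (F G : grading k n d) (a : Fin (n + 1)) :
    dehomogenize (F + G) a = dehomogenize F a + dehomogenize G a := by
  apply HomogeneousLocalization.val_injective
  rw [HomogeneousLocalization.val_add]
  simp only [dehomogenize, HomogeneousLocalization.Away.val_mk, Localization.add_mk_self,
    Submodule.coe_add]

lemma dehomogenize_mul {d e d' : ℕ} (H : grading k n e) (F : grading k n d) (h : e + d = d')
    (hHF : H.1 * F.1 ∈ grading k n d') (a : Fin (n + 1)) :
    dehomogenize (⟨H.1 * F.1, hHF⟩ : grading k n d') a = dehomogenize H a * dehomogenize F a := by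
  subst h
  apply HomogeneousLocalization.val_injective
  rw [HomogeneousLocalization.val_mul]
  simp only [dehomogenize, HomogeneousLocalization.Away.val_mk, Localization.mk_mul]
  congr 1
  exact Subtype.ext (pow_add _ _ _)

/-- A rational function with poles neither at `x₀ = 0` nor at `x₁ = 0` is constant. -/
lemma exists_eq_C_of_mul_pow_eq {z : Rat₂ k} {A B : ℕ} {P Q : MvPolynomial (Fin 2) k}
    (hP : P.IsHomogeneous A) (h₁ : z * ratVar k 1 ^ A = algebraMap _ (Rat₂ k) P)
    (h₀ : z * ratVar k 0 ^ B = algebraMap _ (Rat₂ k) Q) :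
    ∃ c : k, z = algebraMap (MvPolynomial (Fin 2) k) (Rat₂ k) (C c) := by
  have h : P * X 0 ^ B = X 1 ^ A * Q := by
    apply IsFractionRing.injective (MvPolynomial (Fin 2) k) (Rat₂ k)
    rw [map_mul, map_mul, ← h₁, ← h₀, map_pow, map_pow]
    ring
  -- Since `x₁` is prime and does not divide `x₀`, the whole denominator cancels. The quotient then
  -- has degree 0.
  have hdvd : (X 1 : MvPolynomial (Fin 2) k) ^ A ∣ P := by
    refine X_prime.pow_dvd_of_dvd_mul_right A (fun h' => ?_) (Dvd.intro _ h.symm)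
    have := X_prime.dvd_of_dvd_pow h'
    rw [X_dvd_X] at this
    exact absurd this (by decide)
  obtain ⟨R, rfl⟩ := hdvd
  have hz : z = algebraMap (MvPolynomial (Fin 2) k) (Rat₂ k) R := by
    rw [map_mul, map_pow, mul_comm] at h₁
    exact mul_left_cancel₀ (pow_ne_zero A (ratVar_ne_zero 1)) h₁
  rcases eq_or_ne R 0 with rfl | hR
  · exact ⟨0, by rw [hz]; simp⟩
  have hX : (X 1 ^ A : MvPolynomial (Fin 2) k) ≠ 0 := pow_ne_zero _ (X_ne_zero _)
  have hdeg := hP.totalDegree (mul_ne_zero hX hR)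
  rw [totalDegree_mul_of_isDomain hX hR, totalDegree_X_pow] at hdeg
  have hR0 : R.totalDegree = 0 := by omega
  exact ⟨coeff 0 R, by rw [hz, ← totalDegree_eq_zero_iff_eq_C.1 hR0]⟩

/-- The cubic is chosen so that its differential along the curve is a power of `x₁` times `β_i`. It
isolates one conormal coefficient up to a unit on `D₊(u_0)`. -/
lemma snd_deform_first_chart (ℓ : ℕ → Rat₂ k) {i : ℕ} (hi : i + 1 < n) :
    (deform n ℓ (coord k n 0 * minor k n 0 (i + 1) - coord k n 1 * minor k n 0 i)).snd =
      ratVar k 1 ^ (2 * n - 2) * conormalCoeff ℓ i := by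
  rw [map_sub, TrivSqZeroExt.snd_sub, snd_deform_mul ℓ (veronese_minor (by omega) hi),
    snd_deform_mul ℓ (veronese_minor (by omega) (by omega)), snd_deform_minor ℓ (by omega) hi,
    snd_deform_minor ℓ (by omega) (by omega), veronese_coord (by omega), veronese_coord (by omega),
    conormalCoeff]
  obtain ⟨r, rfl⟩ := Nat.exists_eq_add_of_lt hi
  rw [show i + 1 + r + 1 - 0 = i + r + 2 by omega, show i + 1 + r + 1 - (0 + 1) = i + r + 1 by omega,
    show i + 1 + r + 1 - (i + 1 + 1) = r by omega,
    show i + 1 + r + 1 - (i + 1) = r + 1 by omega, show i + 1 + r + 1 - i = r + 2 by omega,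
    show 2 * (i + 1 + r + 1) - 2 = 2 * (i + r + 1) by omega]
  simp only [map_mul, map_pow, map_ofNat]
  ring

/-- The mirror image on `D₊(u_n)`, with a power of `x₀`. -/
lemma snd_deform_last_chart (ℓ : ℕ → Rat₂ k) {i : ℕ} (hi : i + 1 < n) :
    (deform n ℓ (coord k n n * minor k n i (n - 1) -
        coord k n (n - 1) * minor k n (i + 1) (n - 1))).snd =
      ratVar k 0 ^ (2 * n - 2) * conormalCoeff ℓ i := by
  rw [map_sub, TrivSqZeroExt.snd_sub, snd_deform_mul ℓ (veronese_minor (by omega) (by omega)),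
    snd_deform_mul ℓ (veronese_minor (by omega) (by omega)),
    snd_deform_minor ℓ (by omega) (by omega),
    snd_deform_minor ℓ (by omega) (by omega), veronese_coord (by omega), veronese_coord (by omega),
    conormalCoeff]
  obtain ⟨r, rfl⟩ := Nat.exists_eq_add_of_lt hi
  rw [show i + 1 + r + 1 - 1 = i + 1 + r by omega, Nat.sub_self,
    show i + 1 + r + 1 - (i + 1 + r) = 1 by omega, show i + 1 + r + 1 - (i + 1 + 1) = r by omega,
    show i + 1 + r + 1 - (i + 1) = r + 1 by omega, show i + 1 + r + 1 - i = r + 2 by omega,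
    show 2 * (i + 1 + r + 1) - 2 = 2 * (i + r + 1) by omega]
  simp only [map_mul, map_pow, map_ofNat]
  ring

/-! ### From an arbitrary canonical ribbon to a linear form. -/

section Converse

variable (ψ : ∀ a : Fin (n + 1), chartIdeal (rationalNormalCurve k n) a →+ Rat₂ k)

/-- The value of `ψ` on a section over `D₊(u_a)` of the twisted ideal sheaf of the rational normal
curve. -/
def sectionMap (a : Fin (n + 1)) (d : ℕ) : vanishingForms k n d →+ Rat₂ k where
  toFun F := algebraMap _ (Rat₂ k) (veroneseMonomial k n a ^ d) *
    ψ a ⟨dehomogenize (⟨F.1, F.2.1⟩ : grading k n d) a,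
      (dehomogenize_mem_rationalNormalCurve_iff _ a).2 F.2.2⟩
  map_zero' := by
    rw [mul_eq_zero]
    right
    convert (ψ a).map_zero
    have := dehomogenize_add (0 : grading k n d) 0 a
    rw [add_zero, left_eq_add] at this
    exact this
  map_add' F G := by
    rw [← mul_add, ← map_add]
    congr 2
    exact Subtype.ext (dehomogenize_add (⟨F.1, F.2.1⟩ : grading k n d) ⟨G.1, G.2.1⟩ a)

variable {ψ}

lemma isModuleMap_sectionMap (a : Fin (n + 1))
    (hψ : ∀ (f : Chart k n a) (g : chartIdeal (rationalNormalCurve k n) a),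
      ψ a (f • g) = restrict k n a f * ψ a g) : IsModuleMap (sectionMap ψ a) := by
  intro e d d' H hH F hd hHF
  have h1 : (⟨dehomogenize (⟨H * F.1, hHF.1⟩ : grading k n d') a,
      (dehomogenize_mem_rationalNormalCurve_iff _ a).2 hHF.2⟩ :
      chartIdeal (rationalNormalCurve k n) a) =
      dehomogenize (⟨H, hH⟩ : grading k n e) a •
        ⟨dehomogenize (⟨F.1, F.2.1⟩ : grading k n d) a,
          (dehomogenize_mem_rationalNormalCurve_iff _ a).2 F.2.2⟩ :=
    Subtype.ext (dehomogenize_mul (⟨H, hH⟩ : grading k n e) ⟨F.1, F.2.1⟩ hd hHF.1 a)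
  change _ * ψ a _ = _ * (_ * ψ a _)
  rw [h1, hψ, ← restrict_dehomogenize_mul (⟨H, hH⟩ : grading k n e) a, ← hd, pow_add, map_mul]
  ring

lemma exists_sectionMap_mul_eq (a : Fin (n + 1))
    (hψ : Set.range (ψ a) = twistSections k n a (-(n + 2 : ℤ)))
    (d : ℕ) (F : vanishingForms k n d) :
    ∃ (N e : ℕ) (s : MvPolynomial (Fin 2) k), s.IsHomogeneous e ∧ e + n + 2 = N * n ∧
      sectionMap ψ a d F * algebraMap _ (Rat₂ k) (veroneseMonomial k n a ^ N) =
        algebraMap _ (Rat₂ k) (veroneseMonomial k n a ^ d * s) := by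
  have h : ψ a ⟨dehomogenize (⟨F.1, F.2.1⟩ : grading k n d) a,
      (dehomogenize_mem_rationalNormalCurve_iff _ a).2 F.2.2⟩ ∈
      twistSections k n a (-(n + 2 : ℤ)) := hψ ▸ ⟨_, rfl⟩
  obtain ⟨N, e, s, he, hs⟩ := h
  refine ⟨N, e, s.1, (mem_homogeneousSubmodule _ _).1 s.2, ?_, ?_⟩
  · zify
    linarith
  · change _ * ψ a _ * _ = _
    rw [mul_assoc, hs, map_mul]

/-- A canonical ribbon is given by a nonzero linear form on `H⁰(ℙ¹, 𝒪(n - 2))`, and this form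
annihilates the quadrics that contain the ribbon. -/
lemma IsCanonicalRibbon.exists_dual (hn : 2 ≤ n) {J : (projSpace k n).IdealSheafData}
    (hJ : IsCanonicalRibbon J) :
    ∃ lam : Module.Dual k (Forms k (n - 2)), lam ≠ 0 ∧
      ∀ q ∈ symmTensors (k := k) (Forms k (n - 2)), VanishesOn (quadric n q) J →
        contract lam q = 0 := by
  obtain ⟨-, ψ, hlin, hcomp, hrange, hker⟩ := hJ
  obtain ⟨ℓ, hℓ⟩ := (isModuleMap_sectionMap 0 (hlin 0)).exists_eq_deformMap
  -- Although `ℓ` comes from the first chart, agreement on overlaps makes it serve every chart.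
  have hindep (a : Fin (n + 1)) (d : ℕ) (F : vanishingForms k n d) :
      sectionMap ψ a d F = (deform n ℓ F.1).snd :=
    (hcomp a 0 d ⟨F.1, F.2.1⟩ _ _).trans (hℓ d F)
  have hconst (i : Fin (n - 1)) : ∃ c : k,
      conormalCoeff ℓ i = algebraMap (MvPolynomial (Fin 2) k) (Rat₂ k) (C c) := by
    have hi := i.2
    have hv0 : veroneseMonomial k n 0 = X 1 ^ n := by simp [veroneseMonomial]
    have hvn : veroneseMonomial k n (Fin.last n) = X 0 ^ n := by simp [veroneseMonomial]
    have hF0 : coord k n 0 * minor k n 0 (i + 1) - coord k n 1 * minor k n 0 i ∈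
        vanishingForms k n (1 + 2) :=
      sub_mem (mul_mem_vanishingForms (coord_mem 0)
          (minor_mem_vanishingForms (by omega) (by omega)))
        (mul_mem_vanishingForms (coord_mem 1) (minor_mem_vanishingForms (by omega) (by omega)))
    have hFn : coord k n n * minor k n i (n - 1) - coord k n (n - 1) * minor k n (i + 1) (n - 1) ∈
        vanishingForms k n (1 + 2) :=
      sub_mem (mul_mem_vanishingForms (coord_mem n)
          (minor_mem_vanishingForms (by omega) (by omega)))
        (mul_mem_vanishingForms (coord_mem (n - 1))
          (minor_mem_vanishingForms (by omega) (by omega)))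
    obtain ⟨N, e, s, hs, he, h0⟩ := exists_sectionMap_mul_eq 0 (hrange 0) _ ⟨_, hF0⟩
    obtain ⟨N', e', s', -, -, h1⟩ :=
      exists_sectionMap_mul_eq (Fin.last n) (hrange (Fin.last n)) _ ⟨_, hFn⟩
    rw [hindep, snd_deform_first_chart ℓ (by omega), hv0] at h0
    rw [hindep, snd_deform_last_chart ℓ (by omega), hvn] at h1
    -- The test forms are cubics, so on the first chart the right side carries `x₁^(3n)`. Cancelling
    -- `x₁^(2n-2)` leaves `x₁^(n+2) s`, whose degree is `nN` because `s` comes from a section of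
    -- `𝒪(-n-2)`. The last chart is symmetric.
    refine exists_eq_C_of_mul_pow_eq (A := n * N) (B := n * N') (P := X 1 ^ (n + 2) * s)
      (Q := X 0 ^ (n + 2) * s') ?_ ?_ ?_
    · convert (isHomogeneous_X_pow (R := k) (1 : Fin 2) (n + 2)).mul hs using 1
      rw [mul_comm]
      omega
    · refine mul_left_cancel₀ (pow_ne_zero (2 * n - 2) (ratVar_ne_zero (k := k) 1)) ?_
      rw [← mul_assoc]
      convert h0 using 1
      · simp only [map_pow, pow_mul]
      · simp only [map_mul, map_pow]
        rw [← mul_assoc, ← pow_add, ← pow_mul]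
        congr 2
        omega
    · refine mul_left_cancel₀ (pow_ne_zero (2 * n - 2) (ratVar_ne_zero (k := k) 0)) ?_
      rw [← mul_assoc]
      convert h1 using 1
      · simp only [map_pow, pow_mul]
      · simp only [map_mul, map_pow]
        rw [← mul_assoc, ← pow_add, ← pow_mul]
        congr 2
        omega
  choose c hc using hconst
  let lam : Module.Dual k (Forms k (n - 2)) := (monomialBasis k n hn).constr k c
  have hlam (i : Fin (n - 1)) : lam (monomialForm k n i) = c i := by
    rw [← monomialBasis_apply hn, Module.Basis.constr_basis]
  have hrep : Represents ℓ lam := fun i => by rw [hlam, hc]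
  refine ⟨lam, fun h0 => ?_, fun q hq hqJ => ?_⟩
  · have hzero (i : Fin (n - 1)) : conormalCoeff ℓ i = 0 := by
      rw [hrep i, h0]; simp
    have hv := algebraMap_veroneseMonomial_ne_zero (k := k) (n := n) 0
    have hb := (map_ne_zero_iff _ (IsFractionRing.injective (MvPolynomial (Fin 2) k) (Rat₂ k))).2
      (show (monomialForm k n ⟨0, by omega⟩).1 ≠ 0 from
        mul_ne_zero (pow_ne_zero _ (X_ne_zero _)) (pow_ne_zero _ (X_ne_zero _)))
    -- The section `x₁^(n-2) / x₁^(2n)` of `𝒪(-n-2)` on the first chart is nonzero, so surjectivity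
    -- rules out `λ = 0`, for which every ε-part would vanish.
    have hz : algebraMap _ (Rat₂ k) (monomialForm k n ⟨0, by omega⟩).1 /
        algebraMap _ (Rat₂ k) (veroneseMonomial k n 0) ^ 2 ∈
        twistSections k n 0 (-(n + 2 : ℤ)) := by
      refine ⟨2, n - 2, monomialForm k n ⟨0, by omega⟩, ?_, ?_⟩
      · push_cast [hn]; ring
      · rw [map_pow, div_mul_cancel₀ _ (pow_ne_zero 2 hv)]
    rw [← hrange 0] at hz
    obtain ⟨⟨g, hg⟩, hz⟩ := hz
    obtain ⟨d, F, rfl⟩ := dehomogenize_surjective 0 g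
    have hF := (dehomogenize_mem_rationalNormalCurve_iff F 0).1 hg
    obtain ⟨γ, hγ, -⟩ := exists_isConormalClass hn F.2 hF
    have h1 := hindep 0 d ⟨F.1, F.2, hF⟩
    rw [snd_deform_of_isConormalClass ℓ hγ] at h1
    simp only [hzero, mul_zero, Finset.sum_const_zero] at h1
    change _ * ψ 0 ⟨dehomogenize F 0, _⟩ = 0 at h1
    rw [hz, map_pow] at h1
    exact mul_ne_zero (pow_ne_zero d hv) (div_ne_zero hb (pow_ne_zero 2 hv)) h1
  · have hF := veronese_quadric hn q
    have h1 := hindep 0 2 ⟨(quadric n q).1, (quadric n q).2, hF⟩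
    have h2 := (hker 0 ⟨dehomogenize (quadric n q) 0,
      (dehomogenize_mem_rationalNormalCurve_iff _ 0).2 hF⟩).2 (hqJ 0)
    change _ * ψ 0 ⟨dehomogenize (quadric n q) 0, _⟩ = _ at h1
    rw [h2, mul_zero, hrep.snd_deform_quadric hn hq] at h1
    exact Subtype.ext ((map_eq_zero_iff _ (IsFractionRing.injective _ _)).1 h1.symm)

end Converse

end

end CanonicalRibbon

theorem mainTheorem9 (k : Type u) [Field k] (n : ℕ) (hn : 2 ≤ n) :
    -- the identification of `S₂ H⁰(ℙ¹, 𝒪(n-2))` with the space of quadrics through the curve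
    Set.BijOn (CanonicalRibbon.quadric (k := k) n)
      (CanonicalRibbon.symmTensors (k := k) (CanonicalRibbon.Forms k (n - 2)))
      {F | CanonicalRibbon.VanishesOn F (CanonicalRibbon.rationalNormalCurve k n)} ∧
    -- quadrics through a given canonical ribbon
    (∀ lam : Module.Dual k (CanonicalRibbon.Forms k (n - 2)), lam ≠ 0 →
      CanonicalRibbon.IsCanonicalRibbon (CanonicalRibbon.ribbon lam) ∧
      ∀ q ∈ CanonicalRibbon.symmTensors (k := k) (CanonicalRibbon.Forms k (n - 2)),
        CanonicalRibbon.VanishesOn (CanonicalRibbon.quadric n q) (CanonicalRibbon.ribbon lam) ↔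
          CanonicalRibbon.contract lam q = 0) ∧
    -- quadrics through some canonical ribbon
    (∀ q ∈ CanonicalRibbon.symmTensors (k := k) (CanonicalRibbon.Forms k (n - 2)),
      ∀ {ι : Type*} [Fintype ι] [DecidableEq ι]
        (b : Module.Basis ι k (CanonicalRibbon.Forms k (n - 2))),
        (∃ J : (CanonicalRibbon.projSpace k n).IdealSheafData,
          CanonicalRibbon.IsCanonicalRibbon J ∧
          CanonicalRibbon.VanishesOn (CanonicalRibbon.quadric n q) J) ↔
        (CanonicalRibbon.tensorMatrix b q).det = 0) := by
  refine ⟨CanonicalRibbon.bijOn_quadric hn, fun lam hlam =>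
    ⟨CanonicalRibbon.isCanonicalRibbon_ribbon hn hlam, fun q hq =>
      CanonicalRibbon.vanishesOn_ribbon_iff hn lam hq⟩, fun q hq ι _ _ b => ?_⟩
  rw [← CanonicalRibbon.exists_contract_eq_zero_iff_det_eq_zero b hq]
  constructor
  · rintro ⟨J, hJ, hqJ⟩
    -- Identifying `J` with the ribbon of `λ` is unnecessary: it suffices that `λ` annihilates the
    -- quadrics containing `J`.
    obtain ⟨lam, h0, h⟩ := hJ.exists_dual hn
    exact ⟨lam, h0, h q hq hqJ⟩
  · rintro ⟨lam, h0, h⟩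
    exact ⟨_, CanonicalRibbon.isCanonicalRibbon_ribbon hn h0,
      (CanonicalRibbon.vanishesOn_ribbon_iff hn lam hq).2 h⟩
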